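/- Let $n\ge 3$ and let $C_n\,\square\, C_n$ be the toroidal grid, i.e. the Cartesian product of two cycles of order $n$. For a vertex $(x,y)$, its row is induced by the vertices $\{(x,z) : z\in C_n\}$ and its column by $\{(z,y) : z\in C_n\}$. A straight-ahead orientation of $C_n\,\square\, C_n$ is an orientation of its edges (each edge receives exactly one of its two directions) such that every row and every column is a directed $n$-cycle; the directions of different rows and columns may be chosen independently. In the game of cops and robber on a digraph $G$ with $k$ cops, the cops first choose initial vertices (several cops may share a vertex), and then the robber chooses his initial vertex, with full information. In each round first the cops move and then the robber moves, where to move means that each cop (respectively, the robber) either stays at its vertex or goes along one arc, in the direction of the arc. The cops win if after finitely many moves some cop is at the same vertex as the robber. The cop number $c(G)$ is the minimum $k$ such that $k$ cops have a strategy that guarantees the robber's capture. Theorem. If $n \ge 3$ and $G$ is any straight-ahead orientation of the toroidal grid $C_n\,\square\, C_n$, then $c(G)\le 319$. -/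

import Mathlib

/-! ### Oriented toroidal grids -/

namespace CopsRobber

/-- `D` is an orientation of the simple graph `G`: each edge of `G` is replaced by exactly one of
its two arcs, and `D` has no other arcs. -/
structure IsOrientationOf {V : Type*} (D : Digraph V) (G : SimpleGraph V) : Prop where
  adj_iff : ∀ u v, G.Adj u v ↔ D.Adj u v ∨ D.Adj v u
  asymm : ∀ u v, D.Adj u v → ¬ D.Adj v u

/-- The directed cycle `0 → 1 → ⋯ → n - 1 → 0`. -/
def directedCycle (n : ℕ) : Digraph (Fin n) where
  Adj i j := (j : ℕ) = ((i : ℕ) + 1) % n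

/-- The digraph `D` is (isomorphic to) the directed `n`-cycle. -/
def IsDirectedCycle {V : Type*} (D : Digraph V) (n : ℕ) : Prop :=
  Nonempty (D.Adj ≃r (directedCycle n).Adj)

/-- The `n × n` toroidal grid, i.e. the Cartesian (box) product of two cycles of order `n`. -/
abbrev toroidalGrid (n : ℕ) : SimpleGraph (Fin n × Fin n) :=
  (SimpleGraph.cycleGraph n).boxProd (SimpleGraph.cycleGraph n)

/-- The digraph induced by `D` on `{(x, z) : z}`, with `(x, z)` written as `z`. -/
def rowDigraph {n : ℕ} (D : Digraph (Fin n × Fin n)) (x : Fin n) : Digraph (Fin n) where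
  Adj z w := D.Adj (x, z) (x, w)

/-- The digraph induced by `D` on `{(z, y) : z}`, with `(z, y)` written as `z`. -/
def columnDigraph {n : ℕ} (D : Digraph (Fin n × Fin n)) (y : Fin n) : Digraph (Fin n) where
  Adj z w := D.Adj (z, y) (w, y)

/-- `D` is a straight-ahead orientation of the `n × n` toroidal grid: an orientation in which
every row and every column is a directed `n`-cycle. -/
structure IsStraightAhead {n : ℕ} (D : Digraph (Fin n × Fin n)) : Prop where
  orientation : IsOrientationOf D (toroidalGrid n)
  row : ∀ x, IsDirectedCycle (rowDigraph D x) n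
  column : ∀ y, IsDirectedCycle (columnDigraph D y) n

/-! ### The game of cops and robber on a digraph -/

/-- A legal move of one piece: stay put, or follow an arc. -/
def Step {V : Type*} (D : Digraph V) (u v : V) : Prop :=
  v = u ∨ D.Adj u v

/-- A strategy of `k` cops: initial positions, and a rule that produces the next positions of the
cops from the earlier positions of the robber (oldest first), his current position and the current
positions of the cops. Each cop makes a legal move. -/
structure CopStrategy {V : Type*} (D : Digraph V) (k : ℕ) where
  start : Fin k → V
  next : List V → V → (Fin k → V) → (Fin k → V)
  legal : ∀ (past : List V) (r : V) (c : Fin k → V) (i : Fin k), Step D (c i) (next past r c i)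

/-- The positions of the cops at time `t` (after their first `t` moves), when they follow `σ` and
the robber is at `r s` at time `s`. In each round the cops move first, then the robber. -/
def CopStrategy.position {V : Type*} {D : Digraph V} {k : ℕ} (σ : CopStrategy D k) (r : ℕ → V) :
    ℕ → Fin k → V
  | 0 => σ.start
  | t + 1 => σ.next ((List.range t).map r) (r t) (σ.position r t)

/-- The strategy `σ` is winning: against every choice of an initial vertex and of legal moves by
the robber, after finitely many moves some cop is at the same vertex as the robber, either at the
end of a round (first case) or after a move of the cops (second case). Since `σ` only sees the
robber's moves up to the present, a robber who reacts to the cops is included. -/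
def CopStrategy.IsWinning {V : Type*} {D : Digraph V} {k : ℕ} (σ : CopStrategy D k) : Prop :=
  ∀ r : ℕ → V, (∀ t, Step D (r t) (r (t + 1))) →
    ∃ (t : ℕ) (i : Fin k), σ.position r t i = r t ∨ σ.position r (t + 1) i = r t

/-- `k` cops can guarantee the capture of the robber on `D`. -/
def CopsWin {V : Type*} (D : Digraph V) (k : ℕ) : Prop :=
  ∃ σ : CopStrategy D k, σ.IsWinning

/-- The cop number of `D`: the minimum number of cops that can guarantee the robber's capture
(`⊤` if no finite number of cops can). -/
noncomputable def copNumber {V : Type*} (D : Digraph V) : ℕ∞ :=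
  ⨅ (k : ℕ) (_ : CopsWin D k), (k : ℕ∞)

end CopsRobber

/-!
Eight cops suffice. A straight-ahead orientation is given by the directions `±1` of its rows and
columns (`IsStraightAhead.exists_dirs`). The cops' strategy combines small teams by one principle,
`Force.restrict`: a team that keeps an invariant and never increases a potential, and decreases it
at every robber move of a certain kind, makes the robber give up these moves, because the potential
can drop only finitely often.

*Chasing.* One cop approaches the robber and makes him move in every round. A second cop chases the
robber's *shadow* (`Dirs.shadow`): when the robber enters a column horizontally and then moves along
it, the shadow accompanies him in the adjacent column he came from, provided that both columns have
the same direction, and otherwise it is one step behind him. The shadow makes legal moves, so the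
cop keeps his distance from it, and he gains if the robber steps onto it. Hence the robber stops
doing so (`Dirs.force_arcMove`): having moved horizontally, then vertically, he can turn back
horizontally only if the two columns last visited have opposite directions.

*Guarding.* Let `a` and `a + 1` be adjacent rows of opposite directions. Because the robber reverses
his horizontal direction only where the columns change direction, a single cop in these two rows can
follow his column with a lag of at most one, changing rows at the columns where the robber turns;
and such a cop catches the robber if he crosses from one of the rows to the other
(`Dirs.Guard.step`). To get a cop into that position, two cops wait in the two rows at the ends of a
window of columns. When the robber leaves the window, he passes one of them, who becomes a guard;
two further cops narrow the window (`Dirs.force_guard`).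

*Enclosing.* With two guarded pairs of rows the robber is confined to the rows between them. If the
direction changes there, a guard is placed at the first change, and one of the old guards becomes
free; this repeats until all rows available to the robber have the same direction
(`Dirs.force_of_guards`). Then a cop gets into the robber's column, stays in it, and gains whenever
the robber moves towards him; with one cop on either side, the robber eventually keeps to his row
and runs into a waiting cop (`Dirs.force_rows`).
-/

/-! ### An abstract pursuit game -/

namespace CopsRobber

/-- A team of pursuers on the vertex set `V`: its joint positions, its joint moves (staying is
allowed), and the relation saying that a member of the team is at a given vertex. -/
structure Team (V : Type) where
  Pos : Type
  move : Pos → Pos → Prop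
  cap : Pos → V → Prop
  move_refl : ∀ c, move c c

/-- A single cop whose moves are given by a reflexive relation. -/
abbrev Team.single {V : Type} (S : V → V → Prop) (hS : ∀ v, S v v) : Team V :=
  ⟨V, S, fun c v => c = v, hS⟩

/-- Two teams playing together. -/
abbrev Team.pair {V : Type} (A B : Team V) : Team V :=
  ⟨A.Pos × B.Pos, fun c d => A.move c.1 d.1 ∧ B.move c.2 d.2,
    fun c v => A.cap c.1 v ∨ B.cap c.2 v, fun c => ⟨A.move_refl c.1, B.move_refl c.2⟩⟩

/-- `k` cops with the same moves. -/
abbrev Team.power {V : Type} (S : V → V → Prop) (hS : ∀ v, S v v) (k : ℕ) : Team V :=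
  ⟨Fin k → V, fun c d => ∀ i, S (c i) (d i), fun c v => ∃ i, c i = v, fun c i => hS (c i)⟩

/-- `Force A loc T Tgt c w`: with the robber to move from the state `w`, the team `A` at `c` can
enforce, in finitely many rounds, a capture or a pair of states satisfying `Tgt`. The robber moves
in a set `W` of states according to the relation `T`, and `loc` gives his vertex. A robber without
a legal move has lost. -/
inductive Force {V W : Type} (A : Team V) (loc : W → V) (T : W → W → Prop)
    (Tgt : A.Pos → W → Prop) : A.Pos → W → Prop
  | done (c w) : Tgt c w → Force A loc T Tgt c w
  | cap (c w) : A.cap c (loc w) → Force A loc T Tgt c w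
  | step' (c w) (f : ∀ w', T w w' → A.Pos) : (∀ w' h, A.move c (f w' h)) →
      (∀ w' h, Force A loc T Tgt (f w' h) w') → Force A loc T Tgt c w

namespace Force

variable {V W : Type} {A B : Team V} {loc : W → V} {T T' : W → W → Prop}
  {Tgt Tgt' : A.Pos → W → Prop}

theorem step {c : A.Pos} {w : W}
    (H : ∀ w', T w w' → ∃ c', A.move c c' ∧ Force A loc T Tgt c' w') :
    Force A loc T Tgt c w := by
  choose f hf hf' using H
  exact .step' c w f hf hf'

theorem bind {c : A.Pos} {w : W} (H : Force A loc T Tgt c w)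
    (h : ∀ c w, Tgt c w → Force A loc T Tgt' c w) : Force A loc T Tgt' c w := by
  induction H with
  | done c w hc => exact h c w hc
  | cap c w hc => exact .cap c w hc
  | step' c w f hf _ ih => exact .step' c w f hf ih

theorem anti {c : A.Pos} {w : W} (H : Force A loc T Tgt c w)
    (h : ∀ w w', T' w w' → T w w') : Force A loc T' Tgt c w := by
  induction H with
  | done c w hc => exact .done c w hc
  | cap c w hc => exact .cap c w hc
  | step' c w f hf _ ih =>
    exact .step' c w (fun w' hw => f w' (h _ _ hw)) (fun w' _ => hf w' _) (fun w' _ => ih w' _)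

/-- A team simulates another one through a map that preserves moves and captures. This covers
idle additional cops and exchanges of roles. -/
theorem map {TgtB : B.Pos → W → Prop} (f : A.Pos → B.Pos)
    (hm : ∀ c d, A.move c d → B.move (f c) (f d)) (hc : ∀ c x, A.cap c x → B.cap (f c) x)
    (ht : ∀ c w, Tgt c w → TgtB (f c) w) {c : A.Pos} {w : W} (H : Force A loc T Tgt c w) :
    Force B loc T TgtB (f c) w := by
  induction H with
  | done c w h => exact .done _ w (ht _ _ h)
  | cap c w h => exact .cap _ w (hc _ _ h)
  | step' c w g hg _ ih =>
    exact .step' _ w (fun w' hw => f (g w' hw)) (fun w' hw => hm _ _ (hg w' hw)) ih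

/-- The basic composition principle. A team `X` keeps an invariant `I` and a potential `φ` which
never increases and strictly drops at every robber move outside `T'`. Since the potential can only
drop finitely often, a team `A` that succeeds from everywhere against a robber restricted to `T'`
succeeds together with `X` against `T`. At any moment `X` may also enter a position from which
success is already known. -/
theorem restrict {X : Team V} {TgtX : (A.pair X).Pos → W → Prop} (I : X.Pos → W → Prop)
    (φ : X.Pos → W → ℕ)
    (hA : ∀ c w, Force A loc T' Tgt c w)
    (hdone : ∀ c x w, Tgt c w → I x w → Force (A.pair X) loc T TgtX (c, x) w)
    (hstep : ∀ x w w', I x w → ¬ X.cap x (loc w) → T w w' → ∃ x', X.move x x' ∧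
      (X.cap x' (loc w') ∨ (∀ c, Force (A.pair X) loc T TgtX (c, x') w') ∨
        (I x' w' ∧ (φ x' w' < φ x w ∨ (φ x' w' ≤ φ x w ∧ T' w w'))))) :
    ∀ c x w, I x w → Force (A.pair X) loc T TgtX (c, x) w := by
  suffices key : ∀ k c x w, I x w → φ x w ≤ k → Force (A.pair X) loc T TgtX (c, x) w from
    fun c x w hI => key _ c x w hI le_rfl
  intro k
  induction k using Nat.strong_induction_on with
  | _ k ihk =>
    intro c x w hI hφ
    have H := hA c w
    induction H generalizing x with
    | done c w h => exact hdone c x w h hI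
    | cap c w h => exact .cap _ _ (Or.inl h)
    | step' c w f hf _ ih =>
      by_cases hcap : X.cap x (loc w)
      · exact .cap _ _ (Or.inr hcap)
      refine step fun w' hT => ?_
      obtain ⟨x', hx, h | h | ⟨hI', h | ⟨h, hT'⟩⟩⟩ := hstep x w w' hI hcap hT
      · exact ⟨(c, x'), ⟨A.move_refl c, hx⟩, .cap _ _ (Or.inr h)⟩
      · exact ⟨(c, x'), ⟨A.move_refl c, hx⟩, h c⟩
      · exact ⟨(c, x'), ⟨A.move_refl c, hx⟩, ihk (φ x' w') (by omega) c x' w' hI' le_rfl⟩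
      · exact ⟨(f w' hT', x'), ⟨hf w' hT', hx⟩, ih w' hT' x' hI' (by omega)⟩

/-- A potential that drops at every robber move enforces a capture. -/
theorem of_potential (I : A.Pos → W → Prop) (φ : A.Pos → W → ℕ)
    (hstep : ∀ x w w', I x w → ¬ A.cap x (loc w) → T w w' → ∃ x', A.move x x' ∧
      (A.cap x' (loc w') ∨ (I x' w' ∧ φ x' w' < φ x w))) :
    ∀ x w, I x w → Force A loc T Tgt x w := by
  suffices key : ∀ k x w, I x w → φ x w ≤ k → Force A loc T Tgt x w from
    fun x w hI => key _ x w hI le_rfl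
  intro k
  induction k using Nat.strong_induction_on with
  | _ k ihk =>
    intro x w hI hφ
    by_cases hcap : A.cap x (loc w)
    · exact .cap _ _ hcap
    refine step fun w' hT => ?_
    obtain ⟨x', hx, h | ⟨hI', h⟩⟩ := hstep x w w' hI hcap hT
    · exact ⟨x', hx, .cap _ _ h⟩
    · exact ⟨x', hx, ihk _ (by omega) x' w' hI' le_rfl⟩

end Force

/-- `Within M k u z`: the position `z` can be reached from `u` in `k` moves of `M`. -/
def Within {P : Type} (M : P → P → Prop) : ℕ → P → P → Prop
  | 0, u, z => u = z
  | k + 1, u, z => ∃ u', M u u' ∧ Within M k u' z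

namespace Within

variable {P Q : Type} {M : P → P → Prop} {N : Q → Q → Prop}

theorem snoc {k : ℕ} {u z z' : P} (h : Within M k u z) (hz : M z z') : Within M (k + 1) u z' := by
  induction k generalizing u with
  | zero => exact ⟨z', (show u = z from h) ▸ hz, rfl⟩
  | succ k ih =>
    obtain ⟨u', hu, h⟩ := h
    exact ⟨u', hu, ih h⟩

theorem trans {k l : ℕ} {u z z' : P} (h : Within M k u z) (h' : Within M l z z') :
    Within M (l + k) u z' := by
  induction k generalizing u with
  | zero => exact (show u = z from h) ▸ h'
  | succ k ih =>
    obtain ⟨u', hu, h⟩ := h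
    exact ⟨u', hu, ih h⟩

theorem mono (hM : ∀ c, M c c) {k l : ℕ} (hkl : k ≤ l) {u z : P} (h : Within M k u z) :
    Within M l u z := by
  induction l, hkl using Nat.le_induction with
  | base => exact h
  | succ l _ ih => exact ⟨u, hM u, ih⟩

theorem prod {k : ℕ} {u z : P} {u' z' : Q} (h : Within M k u z) (h' : Within N k u' z') :
    Within (fun c d : P × Q => M c.1 d.1 ∧ N c.2 d.2) k (u, u') (z, z') := by
  induction k generalizing u u' with
  | zero => exact Prod.ext h h'
  | succ k ih =>
    obtain ⟨a, ha, h⟩ := h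
    obtain ⟨b, hb, h'⟩ := h'
    exact ⟨(a, b), ⟨ha, hb⟩, ih h h'⟩

end Within

/-- The team can move from any position to any other one. -/
def Team.Connected {V : Type} (A : Team V) : Prop := ∀ c d, ∃ k, Within A.move k c d

theorem Team.Connected.pair {V : Type} {A B : Team V} (hA : A.Connected) (hB : B.Connected) :
    (A.pair B).Connected := by
  rintro ⟨c, c'⟩ ⟨d, d'⟩
  obtain ⟨k, hk⟩ := hA c d
  obtain ⟨l, hl⟩ := hB c' d'
  exact ⟨max k l, .prod (hk.mono A.move_refl (le_max_left _ _))
    (hl.mono B.move_refl (le_max_right _ _))⟩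

theorem Team.Connected.force {V W : Type} {A : Team V} (hA : A.Connected) {loc : W → V}
    {T : W → W → Prop} (z c : A.Pos) (w : W) : Force A loc T (fun d _ => d = z) c w := by
  obtain ⟨k, hk⟩ := hA c z
  induction k generalizing c w with
  | zero => exact .done _ _ hk
  | succ k ih =>
    obtain ⟨c', hc, hk⟩ := hk
    exact .step fun w' _ => ⟨c', hc, ih c' w' hk⟩

/-- The least number of moves from `u` to `z` (`0` if there is no way). -/
noncomputable def moveDist {P : Type} (M : P → P → Prop) (u z : P) : ℕ :=
  sInf {k | Within M k u z}

theorem moveDist_le {P : Type} {M : P → P → Prop} {u z : P} {k : ℕ} (h : Within M k u z) :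
    moveDist M u z ≤ k := Nat.sInf_le h

/-- A pursuer for whom `z` has come within distance `k + 1` restores the distance `k`. -/
theorem exists_move_moveDist_le {P : Type} {M : P → P → Prop}
    (hconn : ∀ c d, ∃ k, Within M k c d) {u z z' : P} (hz : M z z') :
    ∃ u', M u u' ∧ moveDist M u' z' ≤ moveDist M u z := by
  have h : Within M (moveDist M u z) u z := Nat.sInf_mem (hconn u z)
  obtain ⟨u', hu, h'⟩ := h.snoc hz
  exact ⟨u', hu, moveDist_le h'⟩

/-- A pursuer can get nearer to a target that does not move. -/
theorem exists_move_moveDist_lt {P : Type} {M : P → P → Prop}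
    (hconn : ∀ c d, ∃ k, Within M k c d) {u z : P} (hne : u ≠ z) :
    ∃ u', M u u' ∧ moveDist M u' z < moveDist M u z := by
  have h : Within M (moveDist M u z) u z := Nat.sInf_mem (hconn u z)
  rcases hd : moveDist M u z with _ | k
  · rw [hd] at h
    exact absurd h hne
  · rw [hd] at h
    obtain ⟨u', hu, h'⟩ := h
    exact ⟨u', hu, Nat.lt_succ_of_le (moveDist_le h')⟩

/-! ### From the abstract game to strategies -/

/-- The cops capture within `k` rounds; see `Force`. -/
def ForceIn {V : Type} (S : V → V → Prop) {m : ℕ} : ℕ → (Fin m → V) → V → Prop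
  | 0, c, r => ∃ i, c i = r
  | k + 1, c, r => (∃ i, c i = r) ∨
      ∀ r', S r r' → ∃ c' : Fin m → V, (∀ i, S (c i) (c' i)) ∧ ForceIn S k c' r'

theorem ForceIn.mono {V : Type} {S : V → V → Prop} {m k l : ℕ} (hkl : k ≤ l) {c : Fin m → V}
    {r : V} (h : ForceIn S k c r) : ForceIn S l c r := by
  induction k generalizing l c r with
  | zero =>
    cases l with
    | zero => exact h
    | succ l => exact Or.inl h
  | succ k ih =>
    obtain ⟨l, rfl⟩ : ∃ l', l = l' + 1 := ⟨l - 1, by omega⟩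
    rcases h with h | h
    · exact Or.inl h
    · refine Or.inr fun r' hr => ?_
      obtain ⟨c', hc, h'⟩ := h r' hr
      exact ⟨c', hc, ih (by omega) h'⟩

theorem Force.exists_forceIn {V : Type} [Finite V] {S : V → V → Prop} (hS : ∀ v, S v v) {m : ℕ}
    {c : (Team.power S hS m).Pos} {r : V}
    (h : Force (Team.power S hS m) id S (fun _ _ => False) c r) : ∃ k, ForceIn S k c r := by
  induction h with
  | done c w h => exact h.elim
  | cap c w h => exact ⟨0, h⟩
  | step' c w f hf _ ih =>
    choose g hg using ih
    classical
    cases nonempty_fintype V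
    refine ⟨(Finset.univ.sup fun r' => if h : S w r' then g r' h else 0) + 1,
      Or.inr fun r' hr => ⟨f r' hr, hf r' hr, (hg r' hr).mono ?_⟩⟩
    have := Finset.le_sup (f := fun r' => if h : S w r' then g r' h else 0) (Finset.mem_univ r')
    simpa [hr] using this

theorem copsWin_of_force {V : Type} [Finite V] [Nonempty V] {D : Digraph V} {S : V → V → Prop}
    (hS : ∀ v, S v v) (hD : Step D = S) {m : ℕ}
    (h : ∀ c r, Force (Team.power S hS m) id S (fun _ _ => False) c r) : CopsWin D m := by
  classical
  subst hD
  have hk := fun c r => (h c r).exists_forceIn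
  -- The cops always move to a position with a least number of remaining rounds.
  let good (r : V) (c c' : Fin m → V) (k : ℕ) : Prop :=
    (∀ i, Step D (c i) (c' i)) ∧ ForceIn (Step D) k c' r
  have hex : ∀ r c, ∃ k, ∃ c', good r c c' k := fun r c =>
    (hk c r).imp fun k hk => ⟨c, fun _ => Or.inl rfl, hk⟩
  let nx (r : V) (c : Fin m → V) : Fin m → V := (Nat.find_spec (hex r c)).choose
  have hnx : ∀ r c, good r c (nx r c) (Nat.find (hex r c)) := fun r c =>
    (Nat.find_spec (hex r c)).choose_spec
  have hmin : ∀ r c c' k, good r c c' k → ForceIn (Step D) k (nx r c) r := fun r c c' k hg =>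
    (hnx r c).2.mono (Nat.find_min' _ ⟨c', hg⟩)
  let σ : CopStrategy D m :=
    { start := fun _ => Classical.arbitrary V
      next := fun _ r c => nx r c
      legal := fun _ r c i => (hnx r c).1 i }
  refine ⟨σ, fun r hr => ?_⟩
  have key : ∀ k t, ForceIn (Step D) k (σ.position r (t + 1)) (r t) →
      ∃ t i, σ.position r (t + 1) i = r t := by
    intro k
    induction k with
    | zero => exact fun t ⟨i, hi⟩ => ⟨t, i, hi⟩
    | succ k ih =>
      rintro t (⟨i, hi⟩ | hstep)
      · exact ⟨t, i, hi⟩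
      · obtain ⟨c', hc, hf⟩ := hstep _ (hr t)
        exact ih (t + 1) (hmin _ _ c' k ⟨hc, hf⟩)
  obtain ⟨k, hk⟩ := hk (σ.position r 1) (r 0)
  obtain ⟨t, i, hi⟩ := key k 0 hk
  exact ⟨t, i, Or.inr hi⟩

end CopsRobber

/-! ### Toroidal grids given by the directions of their rows and columns -/

namespace CopsRobber

/-- The directions of the rows and columns of a straight-ahead oriented toroidal grid on
`ZMod n × ZMod n`: the arcs are `(y, x) → (y, x + h y)` and `(y, x) → (y + v x, x)`. -/
structure Dirs (n : ℕ) where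
  h : ZMod n → ZMod n
  v : ZMod n → ZMod n
  h_sign : ∀ y, h y = 1 ∨ h y = -1
  v_sign : ∀ x, v x = 1 ∨ v x = -1

/-- The vertices of the toroidal grid: pairs of a row and a column. -/
abbrev Vertex (n : ℕ) : Type := ZMod n × ZMod n

section Sign

variable {n : ℕ} {s t : ZMod n}

theorem neZero_of_three_le [hn : Fact (3 ≤ n)] : NeZero n := ⟨by have := hn.out; omega⟩

theorem one_ne_neg_one [hn : Fact (3 ≤ n)] : (1 : ZMod n) ≠ -1 := by
  have : Fact (2 < n) := ⟨hn.out⟩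
  exact (ZMod.neg_one_ne_one).symm

theorem one_ne_zero_of_three_le [hn : Fact (3 ≤ n)] : (1 : ZMod n) ≠ 0 := by
  have : Fact (1 < n) := ⟨by have := hn.out; omega⟩
  exact one_ne_zero

theorem sign_ne_zero [Fact (3 ≤ n)] (hs : s = 1 ∨ s = -1) : s ≠ 0 := by
  have := one_ne_zero_of_three_le (n := n)
  rcases hs with rfl | rfl
  · exact this
  · exact neg_ne_zero.2 this

theorem sign_ne_neg [Fact (3 ≤ n)] (hs : s = 1 ∨ s = -1) : s ≠ -s := by
  have := one_ne_neg_one (n := n)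
  rcases hs with rfl | rfl
  · exact this
  · rw [neg_neg]; exact this.symm

theorem sign_neg (hs : s = 1 ∨ s = -1) : -s = 1 ∨ -s = -1 := by
  rcases hs with rfl | rfl <;> simp

theorem sign_eq_or (hs : s = 1 ∨ s = -1) (ht : t = 1 ∨ t = -1) : t = s ∨ t = -s := by
  rcases hs with rfl | rfl <;> rcases ht with rfl | rfl <;> simp

theorem sign_mul_self (hs : s = 1 ∨ s = -1) : s * s = 1 := by
  rcases hs with rfl | rfl <;> simp

end Sign

namespace Dirs

variable {n : ℕ} (G : Dirs n)

/-- The arcs of the oriented grid. -/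
def Arc (u w : Vertex n) : Prop :=
  (w.1 = u.1 ∧ w.2 = u.2 + G.h u.1) ∨ (w.2 = u.2 ∧ w.1 = u.1 + G.v u.2)

/-- A legal move: stay, or follow an arc. -/
def Move (u w : Vertex n) : Prop := w = u ∨ G.Arc u w

theorem move_refl (u : Vertex n) : G.Move u u := Or.inl rfl

/-- One cop on the grid. -/
abbrev cop : Team (Vertex n) := Team.single G.Move G.move_refl

/-- A state `w` of the robber consists of his vertex `w.1` and of his *shadow* `w.2`, a vertex that
the chasing cop aims at; `G.shadow w r'` is the new shadow when he moves to `r'`. It is the vertex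
just left, except that the shadow runs alongside a robber who moves vertically when it is next to
him in his row and its column has the same direction as his own. If he steps onto his shadow, it
coincides with him. -/
def shadow (w : Vertex n × Vertex n) (r' : Vertex n) : Vertex n :=
  open Classical in
  if r' = w.2 then r'
  else if w.2.1 = w.1.1 ∧ (w.2.2 = w.1.2 + 1 ∨ w.2.2 = w.1.2 - 1) ∧ r'.2 = w.1.2 ∧
    G.v w.2.2 = G.v w.1.2 then (r'.1, w.2.2)
  else w.1

/-- All moves of the robber, with his shadow. -/
def FullMove (w w' : Vertex n × Vertex n) : Prop := G.Move w.1 w'.1 ∧ w'.2 = G.shadow w w'.1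

/-- The moves of the robber that follow an arc. -/
def ArcMove (w w' : Vertex n × Vertex n) : Prop := G.Arc w.1 w'.1 ∧ w'.2 = G.shadow w w'.1

/-- The moves of the robber that follow an arc and do not lead to his shadow. -/
def ShyMove (w w' : Vertex n × Vertex n) : Prop := G.ArcMove w w' ∧ w'.1 ≠ w.2

end Dirs
end CopsRobber

/-! ### Guarding a pair of adjacent rows of opposite directions -/

namespace CopsRobber
namespace Dirs

variable {n : ℕ} (G : Dirs n)

/-- The cop `c` is in row `a`, which has direction `s`, and follows the robber's column with a lag
of at most one; columns of direction `t` lead from row `a` to row `a + t`. If he is in the robber's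
column or its direction is `t`, he can change rows in his own column as soon as the robber goes on
in direction `-s`; otherwise the robber's shadow is in the cop's column, and the robber, who avoids
it, does not turn back there. -/
def Half (a s t : ZMod n) (c : Vertex n) (w : Vertex n × Vertex n) : Prop :=
  c.1 = a ∧ ((c.2 = w.1.2 ∧ G.v w.1.2 = t) ∨
    (c.2 = w.1.2 - s ∧ (G.v (w.1.2 - s) = t ∨ w.2 = (w.1.1, w.1.2 - s))))

/-- The cop `c` guards the rows `a` and `a + t`, of directions `s` and `-s`. The position of a cop
who could catch the robber in one move does not count: with the robber to move, a cop right behind a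
robber who runs along row `a` does not prevent him from crossing. -/
def Guard (a s t : ZMod n) (c : Vertex n) (w : Vertex n × Vertex n) : Prop :=
  (G.Half a s t c w ∨ G.Half (a + t) (-s) (-t) c w) ∧ ¬ G.Arc c w.1 ∧ c ≠ w.1

variable {G} {a s t : ZMod n} {c : Vertex n} {w w' : Vertex n × Vertex n}

theorem Guard.symm (h : G.Guard a s t c w) : G.Guard (a + t) (-s) (-t) c w := by
  unfold Guard at *
  rw [add_neg_cancel_right, neg_neg, neg_neg]
  tauto

theorem Guard.of_symm (h : G.Guard (a + t) (-s) (-t) c w) : G.Guard a s t c w := by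
  simpa using h.symm

/-- A move from row `a` to row `b` or back. -/
def Crosses (a b : ZMod n) (w w' : Vertex n × Vertex n) : Prop :=
  (w.1.1 = a ∧ w'.1.1 = b) ∨ (w.1.1 = b ∧ w'.1.1 = a)

theorem ShyMove.shadow_eq_of_column_ne [Fact (3 ≤ n)] (h : G.ShyMove w w') (hc : w'.1.2 ≠ w.1.2) :
    w'.2 = w.1 := by
  obtain ⟨⟨-, hq⟩, hne⟩ := h
  rw [hq, shadow, if_neg hne, if_neg (fun h => hc h.2.2.1)]

/-- The responses of a cop in row `a`. If the robber moves in direction `s` away from him, or into a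
column of direction `t` where he may turn back, he follows along the row; if the robber leaves their
common column in direction `-s`, he changes to row `a + t`; otherwise he stays. -/
theorem Half.step [Fact (3 ≤ n)] (hs : s = 1 ∨ s = -1) (ht : t = 1 ∨ t = -1)
    (ha : G.h a = s) (hb : G.h (a + t) = -s) (H : G.Half a s t c w) (hA : ¬ G.Arc c w.1)
    (hc : c ≠ w.1) (hT : G.ShyMove w w') :
    ∃ c', G.Move c c' ∧ (c' = w'.1 ∨ (G.Guard a s t c' w' ∧ ¬ Crosses a (a + t) w w')) := by
  have hs0 := sign_ne_zero hs
  have ht0 := sign_ne_zero ht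
  have hss := sign_ne_neg hs
  have htt := sign_ne_neg ht
  by_cases hA' : G.Arc c w'.1
  · exact ⟨_, Or.inr hA', Or.inl rfl⟩
  by_cases hc' : c = w'.1
  · exact ⟨c, Or.inl rfl, Or.inl hc'⟩
  have hrow := hT.shadow_eq_of_column_ne
  obtain ⟨⟨hr, hq⟩, hne⟩ := hT
  obtain ⟨⟨y, x⟩, q⟩ := w
  obtain ⟨⟨y', x'⟩, q'⟩ := w'
  obtain ⟨b, z⟩ := c
  obtain ⟨rfl : b = a, H⟩ := H
  simp only [Guard, Half, Crosses, Arc, Move, Prod.mk.injEq, ne_eq, not_or, not_and] at *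
  rcases hr with ⟨rfl, hr⟩ | ⟨rfl, hr⟩
  · -- The robber moves along his row.
    have hcr : ¬ ((y' = b ∧ y' = b + t) ∨ (y' = b + t ∧ y' = b)) := by grind
    rcases sign_eq_or hs (G.h_sign y') with hy | hy <;> rw [hy] at hr <;> subst hr
    · have hq' : q' = (y', x) := hrow (by simpa using hs0)
      rcases H with ⟨rfl, hv⟩ | ⟨rfl, H⟩
      · exact ⟨(b, z), by grind⟩
      · exact ⟨(b, x), by grind⟩
    · have hq' : q' = (y', x) := hrow (by simpa using hs0)
      rcases H with ⟨rfl, hv⟩ | ⟨rfl, H⟩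
      · exact ⟨(b + t, z), by grind⟩
      · exact ⟨(b, x - s), by grind⟩
  · -- The robber moves along his column.
    rcases H with ⟨rfl, hv⟩ | ⟨rfl, H⟩
    · exact ⟨(b, z), by grind⟩
    · by_cases hv : G.v (x' - s) = t
      · exact ⟨(b, x' - s), by grind⟩
      · obtain rfl := H.resolve_left hv
        have hv' := (sign_eq_or ht (G.v_sign (x' - s))).resolve_left hv
        rcases sign_eq_or ht (G.v_sign x') with hx | hx
        · exact ⟨(b, x'), by grind⟩
        · have hq' : q' = (y', x' - s) := by
            have hadj : x' - s = x' + 1 ∨ x' - s = x' - 1 := by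
              rcases hs with hs | hs <;> simp [hs]
            rw [hq, shadow, if_neg (by simpa using hne),
              if_pos ⟨rfl, hadj, rfl, hv'.trans hx.symm⟩]
          exact ⟨(b, x' - s), by grind⟩

/-- A guarding cop can go on guarding the two rows, and catches a robber who crosses them. -/
theorem Guard.step [Fact (3 ≤ n)] (hs : s = 1 ∨ s = -1) (ht : t = 1 ∨ t = -1)
    (ha : G.h a = s) (hb : G.h (a + t) = -s) (H : G.Guard a s t c w) (hT : G.ShyMove w w') :
    ∃ c', G.Move c c' ∧ (c' = w'.1 ∨ (G.Guard a s t c' w' ∧ ¬ Crosses a (a + t) w w')) := by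
  obtain ⟨H | H, hA, hc⟩ := H
  · exact H.step hs ht ha hb hA hc hT
  · obtain ⟨c', h, h' | ⟨h', h''⟩⟩ := H.step (sign_neg hs) (sign_neg ht) hb (by simpa using ha)
      hA hc hT
    · exact ⟨c', h, Or.inl h'⟩
    · refine ⟨c', h, Or.inr ⟨h'.of_symm, fun h => h'' ?_⟩⟩
      rw [add_neg_cancel_right]
      exact Or.symm h

end Dirs
end CopsRobber

/-! ### Chasing the robber -/

namespace CopsRobber
namespace Dirs

variable {n : ℕ} {G : Dirs n}

theorem within_row (G : Dirs n) (y x : ZMod n) (k : ℕ) :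
    Within G.Move k (y, x) (y, x + k * G.h y) := by
  induction k with
  | zero => simp [Within]
  | succ k ih => exact ih.snoc (Or.inr (Or.inl ⟨rfl, by push_cast; ring⟩))

theorem within_column (G : Dirs n) (y x : ZMod n) (k : ℕ) :
    Within G.Move k (y, x) (y + k * G.v x, x) := by
  induction k with
  | zero => simp [Within]
  | succ k ih => exact ih.snoc (Or.inr (Or.inr ⟨rfl, by push_cast; ring⟩))

theorem connected [Fact (3 ≤ n)] : G.cop.Connected := by
  have := neZero_of_three_le (n := n)
  rintro ⟨y, x⟩ ⟨y', x'⟩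
  have h₁ := G.within_row y x ((x' - x) * G.h y).val
  have h₂ := G.within_column y x' ((y' - y) * G.v x').val
  rw [ZMod.natCast_zmod_val, mul_assoc, sign_mul_self (G.h_sign y), mul_one,
    add_sub_cancel] at h₁
  rw [ZMod.natCast_zmod_val, mul_assoc, sign_mul_self (G.v_sign x'), mul_one,
    add_sub_cancel] at h₂
  exact ⟨_, h₁.trans h₂⟩

/-- A cop who always approaches the robber forces him to move on eventually in every round. -/
theorem force_fullMove [Fact (3 ≤ n)] {A : Team (Vertex n)}
    (hA : ∀ c w, Force A Prod.fst G.ArcMove (fun _ _ => False) c w) (c : A.Pos) (e : Vertex n)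
    (w : Vertex n × Vertex n) :
    Force (A.pair G.cop) Prod.fst G.FullMove (fun _ _ => False) (c, e) w := by
  refine Force.restrict (X := G.cop) (fun _ _ => True) (fun e w => moveDist G.Move e w.1) hA
    (fun _ _ _ h => h.elim) (fun e w w' _ hcap hT => ?_) c e w trivial
  obtain ⟨hr | hr, hq⟩ := hT
  · obtain ⟨e', he, hlt⟩ := exists_move_moveDist_lt (M := G.Move) connected hcap
    exact ⟨e', he, Or.inr (Or.inr ⟨trivial, Or.inl (by rwa [hr])⟩)⟩
  · obtain ⟨e', he, hle⟩ := exists_move_moveDist_le (M := G.Move) connected (u := e) (Or.inr hr)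
    exact ⟨e', he, Or.inr (Or.inr ⟨trivial, Or.inr ⟨hle, hr, hq⟩⟩)⟩

/-- The possible positions of the shadow: at the robber, at an in-neighbour of the robber, or next
to him in his row and in a column of the same direction as his. -/
def ValidShadow (G : Dirs n) (w : Vertex n × Vertex n) : Prop :=
  w.2 = w.1 ∨ G.Arc w.2 w.1 ∨
    (w.2.1 = w.1.1 ∧ (w.2.2 = w.1.2 + 1 ∨ w.2.2 = w.1.2 - 1) ∧ G.v w.2.2 = G.v w.1.2)

theorem ArcMove.validShadow {w w' : Vertex n × Vertex n} (hT : G.ArcMove w w') :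
    G.ValidShadow w' := by
  classical
  obtain ⟨hr, hq⟩ := hT
  rw [shadow] at hq
  split_ifs at hq with h₁ h₂
  · exact Or.inl hq
  · obtain ⟨-, hb, hc, hd⟩ := h₂
    exact Or.inr (Or.inr ⟨by rw [hq], by rwa [hq, hc], by rwa [hq, hc]⟩)
  · exact Or.inr (Or.inl (hq ▸ hr))

/-- Unless the robber steps onto his shadow, the shadow makes a legal move. -/
theorem ValidShadow.step [Fact (3 ≤ n)] {w w' : Vertex n × Vertex n} (h : G.ValidShadow w)
    (hT : G.ArcMove w w') :
    (w'.1 = w.2 ∧ w'.2 = w'.1) ∨ (w'.1 ≠ w.2 ∧ w'.2 ≠ w'.1 ∧ G.Move w.2 w'.2 ∧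
      (w.2 = w.1 → w'.2 = w.2)) := by
  classical
  obtain ⟨hr, hq⟩ := hT
  rw [shadow] at hq
  have h1 := one_ne_zero_of_three_le (n := n)
  have hh := sign_ne_zero (G.h_sign w.1.1)
  have hv := sign_ne_zero (G.v_sign w.1.2)
  split_ifs at hq with h₁ h₂
  · exact Or.inl ⟨h₁, hq⟩
  · -- The shadow runs alongside the robber.
    obtain ⟨ha, hb, hc, hd⟩ := h₂
    have hb' : w.2.2 ≠ w.1.2 := by
      rcases hb with hb | hb <;> rw [hb] <;> simpa using h1
    have hr' : w'.1.1 = w.1.1 + G.v w.1.2 := by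
      rcases hr with ⟨-, hr⟩ | ⟨-, hr⟩
      · exact absurd (by simpa [hc] using hr) hh
      · exact hr
    refine Or.inr ⟨h₁, ?_, Or.inr (Or.inr ⟨by rw [hq], by rw [hq, hr', ha, hd]⟩),
      fun h => absurd (congrArg Prod.snd h) hb'⟩
    rw [hq]
    intro h
    exact hb' ((congrArg Prod.snd h).trans hc)
  · -- The shadow moves to the vertex just left by the robber.
    refine Or.inr ⟨h₁, ?_, ?_, fun h => hq.trans h.symm⟩
    · rw [hq]
      intro he
      rcases hr with ⟨-, h⟩ | ⟨-, h⟩ <;> rw [← he] at h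
      · exact hh (by simpa using h)
      · exact hv (by simpa using h)
    rw [hq]
    rcases h with h | h | ⟨ha, hb, hc⟩
    · exact Or.inl h.symm
    · exact Or.inr h
    · obtain ⟨⟨y, x⟩, p, z⟩ := w
      obtain ⟨⟨y', x'⟩, q'⟩ := w'
      simp only [Arc, Move, Prod.mk.injEq] at *
      subst ha
      have := G.h_sign p
      grind

/-- A cop who chases the robber's shadow keeps the robber from stepping onto it, except finitely
often: there he would lose part of his lead. -/
theorem force_arcMove [Fact (3 ≤ n)] {A : Team (Vertex n)}
    (hA : ∀ c w, Force A Prod.fst G.ShyMove (fun _ _ => False) c w) (c : A.Pos) (e : Vertex n)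
    (w : Vertex n × Vertex n) :
    Force (A.pair G.cop) Prod.fst G.ArcMove (fun _ _ => False) (c, e) w := by
  classical
  -- After his first move the robber has a valid shadow.
  refine Force.step fun w' hT => ⟨(c, e), ⟨A.move_refl c, Or.inl rfl⟩, ?_⟩
  refine Force.restrict (X := G.cop) (fun _ w => G.ValidShadow w)
    (fun e w => moveDist G.Move e w.2 + if w.2 = w.1 then 0 else 1) hA
    (fun _ _ _ h => h.elim) (fun e w w' hI hcap hT => ?_) c e w' hT.validShadow
  obtain ⟨h₁, h₂⟩ | ⟨h₁, h₂, h₃, h₄⟩ := hI.step hT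
  · -- The robber steps onto his shadow.
    by_cases he : e = w'.1
    · exact ⟨e, Or.inl rfl, Or.inl he⟩
    obtain ⟨e', he', hlt⟩ := exists_move_moveDist_lt (M := G.Move) connected he
    refine ⟨e', he', Or.inr (Or.inr ⟨hT.validShadow, Or.inl ?_⟩)⟩
    rw [if_pos h₂, h₂, ← h₁]
    omega
  · by_cases hq : w.2 = w.1
    · -- The shadow stays where it is, and the cop gets nearer to it.
      have he : e ≠ w.2 := fun h => hcap (h.trans hq)
      obtain ⟨e', he', hlt⟩ := exists_move_moveDist_lt (M := G.Move) connected he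
      refine ⟨e', he', Or.inr (Or.inr ⟨hT.validShadow, Or.inr ⟨?_, hT, h₁⟩⟩)⟩
      rw [if_neg h₂, if_pos hq, h₄ hq]
      omega
    · obtain ⟨e', he', hle⟩ := exists_move_moveDist_le (M := G.Move) connected (u := e) h₃
      refine ⟨e', he', Or.inr (Or.inr ⟨hT.validShadow, Or.inr ⟨?_, hT, h₁⟩⟩)⟩
      rw [if_neg h₂, if_neg hq]
      omega

/-- The shadow is only a bookkeeping device: it can be forgotten. -/
theorem force_of_shadow {A : Team (Vertex n)} {c : A.Pos} {w : Vertex n × Vertex n}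
    (h : Force A Prod.fst G.FullMove (fun _ _ => False) c w) :
    Force A id G.Move (fun _ _ => False) c w.1 := by
  induction h with
  | done c w h => exact h.elim
  | cap c w h => exact .cap _ _ h
  | step' c w f hf _ ih =>
    exact .step fun r' hr => ⟨_, hf (r', G.shadow w r') ⟨hr, rfl⟩, ih (r', G.shadow w r') ⟨hr, rfl⟩⟩

end Dirs
end CopsRobber

/-! ### A robber who keeps to one row or one column -/

namespace CopsRobber

section Val

variable {n : ℕ} [hn : Fact (3 ≤ n)] {z : ZMod n}

theorem val_sub_one_add_one (hz : z ≠ 0) : (z - 1).val + 1 = z.val := by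
  have := neZero_of_three_le (n := n)
  have h1 : (1 : ZMod n).val = 1 := ZMod.val_one'' (by have := hn.out; omega)
  have hz' : z.val ≠ 0 := by simpa using hz
  rw [ZMod.val_sub (by omega), h1]
  omega

theorem val_add_one_of_lt (hz : z.val + 1 < n) : (z + 1).val = z.val + 1 := by
  have := neZero_of_three_le (n := n)
  have h1 : (1 : ZMod n).val = 1 := ZMod.val_one'' (by have := hn.out; omega)
  rw [ZMod.val_add, h1, Nat.mod_eq_of_lt hz]

end Val

namespace Dirs

variable {n : ℕ} (G : Dirs n)

/-- The moves of the robber within his row. -/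
def RowMove (w w' : Vertex n × Vertex n) : Prop := G.ShyMove w w' ∧ w'.1.1 = w.1.1

/-- The moves of the robber within his column. -/
def ColumnMove (w w' : Vertex n × Vertex n) : Prop := G.ShyMove w w' ∧ w'.1.2 = w.1.2

variable {G}

theorem ShyMove.cases {w w' : Vertex n × Vertex n} {s : ZMod n} (hs : s = 1 ∨ s = -1)
    (h : G.ShyMove w w') :
    (w'.1.1 = w.1.1 ∧ w'.1.2 = w.1.2 + s ∧ G.h w.1.1 = s) ∨
    (w'.1.1 = w.1.1 ∧ w'.1.2 = w.1.2 - s ∧ G.h w.1.1 = -s) ∨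
    (w'.1.2 = w.1.2 ∧ w'.1.1 = w.1.1 + G.v w.1.2) := by
  obtain ⟨⟨⟨h₁, h₂⟩ | ⟨h₁, h₂⟩, -⟩, -⟩ := h
  · rcases sign_eq_or hs (G.h_sign w.1.1) with h | h
    · exact Or.inl ⟨h₁, h ▸ h₂, h⟩
    · exact Or.inr (Or.inl ⟨h₁, by rw [h₂, h, sub_eq_add_neg], h⟩)
  · exact Or.inr (Or.inr ⟨h₁, h₂⟩)

/-- One cop goes to the robber's column and waits there. -/
theorem force_columnMove [Fact (3 ≤ n)] {Tgt : Vertex n → Vertex n × Vertex n → Prop}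
    (e : Vertex n) (w : Vertex n × Vertex n) : Force G.cop Prod.fst G.ColumnMove Tgt e w := by
  have := neZero_of_three_le (n := n)
  refine Force.of_potential (A := G.cop) (fun _ _ => True)
    (fun e w => if e.2 = w.1.2 then ((e.1 - w.1.1) * G.v w.1.2).val
      else n + ((w.1.2 - e.2) * G.h e.1).val) ?_ e w trivial
  rintro ⟨b, z⟩ ⟨⟨y, x⟩, q⟩ ⟨⟨y', x'⟩, q'⟩ - hcap ⟨hT, hx : x' = x⟩
  subst hx
  have hvv := sign_mul_self (G.v_sign x')
  have hhh := sign_mul_self (G.h_sign b)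
  by_cases hz : z = x'
  · subst hz
    have hy : y' = y + G.v z := by
      have := hT.cases (Or.inl rfl)
      have h1 := one_ne_zero_of_three_le (n := n)
      simp only at this
      grind
    have hne : (b - y) * G.v z ≠ 0 := by
      intro h
      have : b - y = 0 := by linear_combination G.v z * h - (b - y) * hvv
      exact hcap (Prod.ext (sub_eq_zero.1 this) rfl)
    have := val_sub_one_add_one hne
    refine ⟨(b, z), Or.inl rfl, Or.inr ⟨trivial, ?_⟩⟩
    simp only [if_true]
    rw [show (b - y') * G.v z = (b - y) * G.v z - 1 by rw [hy]; linear_combination -hvv]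
    omega
  · have hne : (x' - z) * G.h b ≠ 0 := by
      intro h
      have : x' - z = 0 := by linear_combination G.h b * h - (x' - z) * hhh
      exact hz (sub_eq_zero.1 this).symm
    have := val_sub_one_add_one hne
    refine ⟨(b, z + G.h b), Or.inr (Or.inl ⟨rfl, rfl⟩), Or.inr ⟨trivial, ?_⟩⟩
    simp only [if_neg hz]
    split_ifs
    · exact (ZMod.val_lt _).trans_le (Nat.le_add_right _ _)
    · rw [show (x' - (z + G.h b)) * G.h b = (x' - z) * G.h b - 1 by linear_combination -hhh]
      omega

/-- One cop goes to the robber's row and waits there. -/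
theorem force_rowMove [Fact (3 ≤ n)] {Tgt : Vertex n → Vertex n × Vertex n → Prop}
    (e : Vertex n) (w : Vertex n × Vertex n) : Force G.cop Prod.fst G.RowMove Tgt e w := by
  have := neZero_of_three_le (n := n)
  refine Force.of_potential (A := G.cop) (fun _ _ => True)
    (fun e w => if e.1 = w.1.1 then ((e.2 - w.1.2) * G.h w.1.1).val
      else n + ((w.1.1 - e.1) * G.v e.2).val) ?_ e w trivial
  rintro ⟨z, b⟩ ⟨⟨x, y⟩, q⟩ ⟨⟨x', y'⟩, q'⟩ - hcap ⟨hT, hx : x' = x⟩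
  subst hx
  have hvv := sign_mul_self (G.h_sign x')
  have hhh := sign_mul_self (G.v_sign b)
  by_cases hz : z = x'
  · subst hz
    have hy : y' = y + G.h z := by
      have := hT.cases (G.h_sign z)
      have h1 := sign_ne_neg (G.h_sign z)
      have h2 := sign_ne_zero (G.v_sign y)
      simp only at this
      grind
    have hne : (b - y) * G.h z ≠ 0 := by
      intro h
      have : b - y = 0 := by linear_combination G.h z * h - (b - y) * hvv
      exact hcap (Prod.ext rfl (sub_eq_zero.1 this))
    have := val_sub_one_add_one hne
    refine ⟨(z, b), Or.inl rfl, Or.inr ⟨trivial, ?_⟩⟩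
    simp only [if_true]
    rw [show (b - y') * G.h z = (b - y) * G.h z - 1 by rw [hy]; linear_combination -hvv]
    omega
  · have hne : (x' - z) * G.v b ≠ 0 := by
      intro h
      have : x' - z = 0 := by linear_combination G.v b * h - (x' - z) * hhh
      exact hz (sub_eq_zero.1 this).symm
    have := val_sub_one_add_one hne
    refine ⟨(z + G.v b, b), Or.inr (Or.inr ⟨rfl, rfl⟩), Or.inr ⟨trivial, ?_⟩⟩
    simp only [if_neg hz]
    split_ifs
    · exact (ZMod.val_lt _).trans_le (Nat.le_add_right _ _)
    · rw [show (x' - (z + G.v b)) * G.v b = (x' - z) * G.v b - 1 by linear_combination -hhh]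
      omega

end Dirs
end CopsRobber

/-! ### Bringing a cop into a guarding position -/

namespace CopsRobber
namespace Dirs

variable {n : ℕ} (G : Dirs n) {p s t d : ZMod n} {w w' : Vertex n × Vertex n}

/-- The index of column `x` when the columns are counted from `d` in direction `s`. -/
def index (d s x : ZMod n) : ℕ := ((x - d) * s).val

theorem index_self (d s : ZMod n) : index d s d = 0 := by simp [index]

theorem index_injective [Fact (3 ≤ n)] (hs : s = 1 ∨ s = -1) {x x' : ZMod n}
    (h : index d s x = index d s x') : x = x' := by
  have := neZero_of_three_le (n := n)
  have h := ZMod.val_injective n h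
  linear_combination s * h + (x' - x) * sign_mul_self hs

theorem index_add [Fact (3 ≤ n)] (hs : s = 1 ∨ s = -1) {x : ZMod n}
    (h : index d s x + 1 < n) : index d s (x + s) = index d s x + 1 := by
  unfold index at *
  rw [← val_add_one_of_lt h]
  congr 1
  linear_combination sign_mul_self hs

theorem index_sub [Fact (3 ≤ n)] (hs : s = 1 ∨ s = -1) {x : ZMod n}
    (h : index d s x ≠ 0) : index d s (x - s) + 1 = index d s x := by
  have hz : (x - d) * s ≠ 0 := fun h' => h (by simp [index, h'])
  unfold index at *
  rw [← val_sub_one_add_one hz]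
  congr 2
  linear_combination -sign_mul_self hs

theorem index_lt [Fact (3 ≤ n)] (d s x : ZMod n) : index d s x < n := by
  have := neZero_of_three_le (n := n)
  exact ZMod.val_lt _

/-- The moves of a robber who is in the columns of index at most `m` and does not leave them in
either direction. -/
def WindowMove (d s : ZMod n) (m : ℕ) (w w' : Vertex n × Vertex n) : Prop :=
  G.ShyMove w w' ∧ index d s w.1.2 ≤ m ∧ ¬ (w'.1.2 = w.1.2 + s ∧ index d s w.1.2 = m) ∧
    ¬ (w'.1.2 = w.1.2 - s ∧ index d s w.1.2 = 0)

variable {G}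

/-- Against a robber in a window of columns, a cop in row `p` starts at the beginning of the window
and walks whenever the robber moves in direction `s`, so that he does not get nearer to the robber
by his own moves; the robber has to walk past him, and is then in a smaller window. Another cop
takes care of a robber who stays in one column. -/
theorem force_shrink [Fact (3 ≤ n)] (hs : s = 1 ∨ s = -1) (hp : G.h p = s) {m : ℕ}
    (hmn : m < n)     (e e' : Vertex n) (w : Vertex n × Vertex n) :
    Force (G.cop.pair G.cop) Prod.fst (G.WindowMove d s m)
      (fun c w => c.2.1 = p ∧ index d s c.2.2 < m ∧ index d s w.1.2 ≤ index d s c.2.2)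
      (e, e') w := by
  have hs0 := sign_ne_zero hs
  refine Force.bind (Team.Connected.force (A := G.cop.pair G.cop)
    (connected.pair connected) (e, (p, d)) (e, e') w) ?_
  rintro ⟨a, b⟩ w h
  obtain ⟨rfl, rfl⟩ : a = e ∧ b = (p, d) := Prod.mk.inj h
  by_cases hw : index d s w.1.2 ≤ m
  swap
  · exact .step fun w' hT => absurd hT.2.1 hw
  by_cases hw0 : index d s w.1.2 = 0
  · by_cases hm : m = 0
    · -- In a window that consists of one column the robber can only move vertically.
      subst hm
      refine Force.anti (T := G.ColumnMove) (Force.map (A := G.cop) (B := G.cop.pair G.cop)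
        (Tgt := fun _ _ => False)
        (fun c => (c, (p, d))) (fun _ _ h => ⟨h, Or.inl rfl⟩) (fun _ _ h => Or.inl h)
        (fun _ _ h => h.elim) (force_columnMove a w)) ?_
      rintro w w' ⟨hT, h₁, h₂, h₃⟩
      refine ⟨hT, ?_⟩
      rcases hT.cases hs with h | h | h
      · exact absurd ⟨h.2.1, by omega⟩ h₂
      · exact absurd ⟨h.2.1, by omega⟩ h₃
      · exact h.1
    · refine .done _ _ ⟨rfl, ?_⟩
      simp only [index_self]
      omega
  refine Force.restrict (A := G.cop) (X := G.cop) (T' := G.ColumnMove) (Tgt := fun _ _ => False)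
    (fun b w => b.1 = p ∧ index d s b.2 < index d s w.1.2 ∧ index d s w.1.2 ≤ m)
    (fun b w => m + index d s w.1.2 - 2 * index d s b.2) force_columnMove
    (fun _ _ _ h => h.elim) ?_ a (p, d) w ⟨rfl, by simp only [index_self]; omega, hw⟩
  rintro ⟨b, z⟩ w w' ⟨rfl, hlt, hle⟩ - ⟨hT, -, h₂, h₃⟩
  simp only at hlt ⊢
  have hn := index_lt d s w.1.2
  rcases hT.cases hs with ⟨-, h, -⟩ | ⟨-, h, -⟩ | ⟨h, -⟩
  · have hm : index d s w.1.2 ≠ m := fun hm => h₂ ⟨h, hm⟩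
    have hi := index_add (d := d) (x := w.1.2) hs (by omega)
    have hj := index_add (d := d) (x := z) hs (by omega)
    rw [← h] at hi
    refine ⟨(b, z + s), Or.inr (Or.inl ⟨rfl, by rw [hp]⟩), Or.inr (Or.inr ⟨?_, ?_⟩)⟩
    all_goals simp only
    · exact ⟨trivial, by omega, by omega⟩
    · omega
  · have := index_sub hs (fun h0 => h₃ ⟨h, h0⟩)
    rw [← h] at this
    by_cases hj : index d s w'.1.2 = index d s z
    · exact ⟨(b, z), Or.inl rfl, Or.inr (Or.inl fun c => .done _ _ ⟨rfl, by simp only; omega,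
        by simp only; omega⟩)⟩
    · exact ⟨(b, z), Or.inl rfl, Or.inr (Or.inr ⟨⟨rfl, by simp only; omega, by omega⟩,
        Or.inl (by simp only; omega)⟩)⟩
  · exact ⟨(b, z), Or.inl rfl, Or.inr (Or.inr ⟨⟨rfl, by simp only [h]; omega, by rwa [h]⟩,
      Or.inr ⟨by rw [h], hT, h⟩⟩)⟩

/-- A cop waiting in row `p`, of direction `s`, is a guard as soon as the robber leaves the cop's
column in direction `s` along another row. -/
theorem guard_of_row_move [Fact (3 ≤ n)] (hs : s = 1 ∨ s = -1) {c : Vertex n}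
    (hT : G.ShyMove w w') (hrow : w'.1.1 = w.1.1) (hx : w'.1.2 = w.1.2 + s) (hc : c.1 = p)
    (hc' : c.2 = w.1.2) (hne : c ≠ w.1) : G.Guard p s t c w' := by
  have hs0 := sign_ne_zero hs
  have hq : w'.2 = w.1 := hT.shadow_eq_of_column_ne (by rw [hx]; simpa using hs0)
  obtain ⟨⟨y, x⟩, q⟩ := w
  obtain ⟨⟨y', x'⟩, q'⟩ := w'
  obtain ⟨b, z⟩ := c
  simp only [Guard, Half, Arc, ne_eq, Prod.mk.injEq] at *
  grind

/-- Four cops can bring one of them into a position that guards the rows `p` and `p + t`.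
Two of them wait in these rows so that the robber, whenever he leaves a window of columns, makes
one of them a guard; the window is narrowed by the other two. -/
theorem force_guard [Fact (3 ≤ n)] (hs : s = 1 ∨ s = -1) (hp : G.h p = s)
    (c : (Team.power G.Move G.move_refl 4).Pos) (w : Vertex n × Vertex n) :
    Force (Team.power G.Move G.move_refl 4) Prod.fst G.ShyMove
      (fun c w => ∃ i, G.Guard p s t (c i) w) c w := by
  have := neZero_of_three_le (n := n)
  let A : Team (Vertex n) := (G.cop.pair G.cop).pair (G.cop.pair G.cop)
  let Tgt : A.Pos → Vertex n × Vertex n → Prop := fun c w =>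
    G.Guard p s t c.1.2 w ∨ G.Guard p s t c.2.1 w ∨ G.Guard p s t c.2.2 w
  have key : ∀ m, m < n → ∀ (c : (G.cop.pair G.cop).Pos) (x : (G.cop.pair G.cop).Pos)
      (w : Vertex n × Vertex n),
      (x.1 = (p + t, (0 : ZMod n)) ∧ x.2.1 = p ∧ index 0 s x.2.2 = m ∧ index 0 s w.1.2 ≤ m) →
      Force A Prod.fst G.ShyMove Tgt (c, x) w := by
    intro m
    induction m using Nat.strong_induction_on with
    | _ m ih =>
      intro hmn
      refine Force.restrict (X := G.cop.pair G.cop) (T' := G.WindowMove 0 s m) _ (fun _ _ => 0)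
        (fun c w => force_shrink hs hp hmn c.1 c.2 w) ?_ ?_
      · rintro ⟨e, b⟩ ⟨a, b'⟩ w ⟨h₁, h₂, h₃⟩ ⟨h₄, -, -, -⟩
        -- The cop who narrowed the window changes roles with the one at its old end.
        exact Force.map (A := A) (B := A) (Tgt := Tgt) (TgtB := Tgt)
          (fun c => ((c.1.1, c.2.2), (c.2.1, c.1.2)))
          (fun _ _ h => ⟨⟨h.1.1, h.2.2⟩, ⟨h.2.1, h.1.2⟩⟩)
          (fun _ _ h => by simp only [A] at h ⊢; tauto)
          (fun _ _ h => by simp only [Tgt] at h ⊢; tauto)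
          (ih _ h₂ (h₂.trans hmn) (e, b') (a, b) w ⟨h₄, h₁, rfl, h₃⟩)
      · rintro ⟨a, b⟩ w w' ⟨h₁, h₂, h₃, h₄⟩ hcap hT
        simp only at h₁ h₂ h₃
        have hcap : ¬ (a = w.1 ∨ b = w.1) := hcap
        rw [not_or] at hcap
        have hs0 := sign_ne_zero hs
        have hss := sign_ne_neg hs
        refine ⟨(a, b), ⟨Or.inl rfl, Or.inl rfl⟩, Or.inr ?_⟩
        have hrw : ∀ {x : ZMod n}, x + s ≠ x - s := fun {x} h => hss (by linear_combination h)
        rcases hT.cases hs with ⟨hr, h, -⟩ | ⟨hr, h, -⟩ | ⟨h, -⟩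
        · by_cases hm : index 0 s w.1.2 = m
          · exact Or.inl fun c => .done _ _ (Or.inr (Or.inr (guard_of_row_move hs hT hr h h₂
              (index_injective hs (h₃.trans hm.symm)) hcap.2)))
          · have hi := index_add (d := 0) (x := w.1.2) hs (by omega)
            rw [← h] at hi
            exact Or.inr ⟨⟨h₁, h₂, h₃, by omega⟩, Or.inr ⟨le_rfl, hT, h₄, fun h' => hm h'.2,
              fun h' => hrw (h.symm.trans h'.1)⟩⟩
        · by_cases hm : index 0 s w.1.2 = 0
          · refine Or.inl fun c => .done _ _ (Or.inr (Or.inl (Guard.of_symm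
              (guard_of_row_move (sign_neg hs) hT hr (by rw [h, sub_eq_add_neg]) (by rw [h₁]) ?_
                hcap.1))))
            rw [h₁]
            exact index_injective hs ((index_self _ _).trans hm.symm)
          · have hi := index_sub (d := 0) (x := w.1.2) hs hm
            rw [← h] at hi
            exact Or.inr ⟨⟨h₁, h₂, h₃, by omega⟩, Or.inr ⟨le_rfl, hT, h₄,
              fun h' => hrw (h'.1.symm.trans h), fun h' => hm h'.2⟩⟩
        · refine Or.inr ⟨⟨h₁, h₂, h₃, by rwa [h]⟩, Or.inr ⟨le_rfl, hT, h₄, ?_, ?_⟩⟩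
          · rintro ⟨h', -⟩
            exact hs0 (by linear_combination h - h')
          · rintro ⟨h', -⟩
            exact hs0 (by linear_combination h' - h)
  have hend : index 0 s (0 - s : ZMod n) = n - 1 := by
    unfold index
    rw [show ((0 - s : ZMod n) - 0) * s = -1 by linear_combination -sign_mul_self hs]
    obtain ⟨k, rfl⟩ := Nat.exists_eq_succ_of_ne_zero (NeZero.ne n)
    exact ZMod.val_neg_one k
  have hA : Force A Prod.fst G.ShyMove Tgt ((c 0, c 1), (c 2, c 3)) w := by
    refine Force.bind (Team.Connected.force (A := A)
      ((connected.pair connected).pair (connected.pair connected))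
      ((c 0, c 1), ((p + t, 0), (p, 0 - s))) _ w) ?_
    rintro _ w rfl
    exact key (n - 1) (by have := NeZero.pos n; omega) _ _ w ⟨rfl, rfl, hend, by
      have := index_lt 0 s w.1.2
      omega⟩
  have hf : c = ![c 0, c 1, c 2, c 3] := by
    funext i
    fin_cases i <;> rfl
  rw [hf]
  exact Force.map (A := A) (B := Team.power G.Move G.move_refl 4) (Tgt := Tgt)
    (fun c => ![c.1.1, c.1.2, c.2.1, c.2.2])
    (fun _ _ h i => by fin_cases i <;> [exact h.1.1; exact h.1.2; exact h.2.1; exact h.2.2])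
    (fun _ _ h => by
      rcases h with (h | h) | (h | h)
      exacts [⟨0, h⟩, ⟨1, h⟩, ⟨2, h⟩, ⟨3, h⟩])
    (fun _ _ h => by
      rcases h with h | h | h
      exacts [⟨1, h⟩, ⟨2, h⟩, ⟨3, h⟩]) hA

end Dirs
end CopsRobber

/-! ### A robber confined to rows of one direction -/

namespace CopsRobber
namespace Dirs

variable {n : ℕ} (G : Dirs n) {s t : ZMod n} {w w' : Vertex n × Vertex n}

/-- The moves of the robber within the rows in `R`. -/
def RowsMove (R : Set (ZMod n)) (w w' : Vertex n × Vertex n) : Prop :=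
  G.ShyMove w w' ∧ w.1.1 ∈ R ∧ w'.1.1 ∈ R

variable {G}

/-- Let all rows from `y₀` to the robber, in direction `t`, have direction `s`. A cop starting in
row `y₀` gets into the robber's column, because he gains there at every vertical move of the robber;
then he imitates all moves of the robber except those in direction `-t`, at which he gets nearer to
him. So the robber makes finitely many moves in direction `-t`. -/
theorem force_vertical [Fact (3 ≤ n)] {A : Team (Vertex n)} (hs : s = 1 ∨ s = -1)
    (ht : t = 1 ∨ t = -1) {R : Set (ZMod n)} {y₀ : ZMod n}
    (hR : ∀ y ∈ R, ∀ i : ℕ, i ≤ ((y - y₀) * t).val → G.h (y₀ + t * i) = s)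
    {T : Vertex n × Vertex n → Vertex n × Vertex n → Prop}
    (hT : ∀ w w', T w w' → G.RowsMove R w w')
    (hA : ∀ c w, Force A Prod.fst (fun w w' => T w w' ∧ w'.1.1 ≠ w.1.1 - t)
      (fun _ _ => False) c w) (c : A.Pos) (e : Vertex n) (w : Vertex n × Vertex n) :
    Force (A.pair G.cop) Prod.fst T (fun _ _ => False) (c, e) w := by
  classical
  have := neZero_of_three_le (n := n)
  have htt := sign_mul_self ht
  have hss := sign_mul_self hs
  have hs0 := sign_ne_zero hs
  have ht0 := sign_ne_zero ht
  have htn := sign_ne_neg ht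
  have hval : ∀ z : ZMod n, z.val < n := ZMod.val_lt
  have hrow : ∀ y ∈ R, G.h y = s := by
    intro y hy
    have := hR y hy _ le_rfl
    rw [ZMod.natCast_zmod_val] at this
    rwa [show y₀ + t * ((y - y₀) * t) = y by linear_combination (y - y₀) * htt] at this
  -- `P`: the cop is in the robber's column, and the rows between them have direction `s`. The
  -- potential `φ` is the vertical distance if `P` holds. A larger value measures the horizontal
  -- distance if the cop is in row `y₀`, and a still larger one the distance to `y₀` if not.
  let P (e : Vertex n) (w : Vertex n × Vertex n) : Prop :=
    e.2 = w.1.2 ∧ ∀ i : ℕ, i ≤ ((w.1.1 - e.1) * t).val → G.h (e.1 + t * i) = s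
  let φ (e : Vertex n) (w : Vertex n × Vertex n) : ℕ :=
    if P e w then ((w.1.1 - e.1) * t).val
    else if e.1 = y₀ then n + ((w.1.2 - e.2) * s).val
    else 2 * n + ((y₀ - e.1) * G.v e.2).val
  have hφP : ∀ {e w}, P e w → φ e w = ((w.1.1 - e.1) * t).val := fun h => if_pos h
  have hφ₁ : ∀ {e w}, e.1 = y₀ → φ e w ≤ n + ((w.1.2 - e.2) * s).val := by
    intro e w h
    simp only [φ]
    have := hval ((w.1.1 - e.1) * t)
    split_ifs <;> omega
  have hφ₀ : ∀ e w, φ e w ≤ 2 * n + ((y₀ - e.1) * G.v e.2).val := by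
    intro e w
    simp only [φ]
    have := hval ((w.1.1 - e.1) * t)
    have := hval ((w.1.2 - e.2) * s)
    split_ifs <;> omega
  refine Force.restrict (X := G.cop) (fun _ _ => True) φ hA (fun _ _ _ h => h.elim) ?_ c e w trivial
  rintro ⟨b, z⟩ w w' - hcap hTw
  obtain ⟨hS, hy, hy'⟩ := hT w w' hTw
  have hsy := hrow _ hy
  by_cases hP : P (b, z) w
  · obtain ⟨hz, hP'⟩ := id hP
    simp only at hz
    subst hz
    have hb : G.h b = s := by simpa using hP' 0 (Nat.zero_le _)
    rcases hS.cases hs with ⟨h₁, h₂, -⟩ | ⟨-, -, h₃⟩ | ⟨h₁, h₂⟩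
    · have hP₁ : P (b, w.1.2 + s) w' := ⟨h₂.symm, by rw [h₁]; exact hP'⟩
      refine ⟨(b, w.1.2 + s), Or.inr (Or.inl ⟨rfl, by simp only [hb]⟩), Or.inr (Or.inr ⟨trivial,
        Or.inr ⟨?_, hTw, ?_⟩⟩)⟩
      · rw [hφP hP, hφP hP₁, h₁]
      · rw [h₁]
        intro h
        exact ht0 (by linear_combination h)
    · exact absurd (hsy.symm.trans h₃) (sign_ne_neg hs)
    · rcases sign_eq_or ht (G.v_sign w.1.2) with h | h <;> rw [h] at h₂
      · have hgap : (w'.1.1 - (b + t)) * t = (w.1.1 - b) * t := by rw [h₂]; ring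
        have hP₁ : P (b + t, w.1.2) w' := by
          refine ⟨h₁.symm, fun i hi => ?_⟩
          simp only [hgap] at hi ⊢
          rcases hi.lt_or_eq with hi | rfl
          · have := hP' (i + 1) hi
            push_cast at this
            rwa [show b + t * ((i : ZMod n) + 1) = b + t + t * i by ring] at this
          · rw [ZMod.natCast_zmod_val]
            rw [show b + t + t * ((w.1.1 - b) * t) = w'.1.1 by
              rw [h₂]; linear_combination (w.1.1 - b) * htt]
            exact hrow _ hy'
        refine ⟨(b + t, w.1.2), Or.inr (Or.inr ⟨rfl, by simp only [h]⟩), Or.inr (Or.inr ⟨trivial,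
          Or.inr ⟨?_, hTw, ?_⟩⟩)⟩
        · rw [hφP hP, hφP hP₁]
          simp only [hgap, le_refl]
        · rw [h₂]
          intro h
          exact htn (by linear_combination h)
      · have hne : (w.1.1 - b) * t ≠ 0 := by
          intro h0
          have : w.1.1 - b = 0 := by linear_combination t * h0 - (w.1.1 - b) * htt
          exact hcap (Prod.ext (sub_eq_zero.1 this).symm rfl)
        have hgap : (w'.1.1 - b) * t = (w.1.1 - b) * t - 1 := by
          rw [h₂]; linear_combination -htt
        have hlt := val_sub_one_add_one hne
        rw [← hgap] at hlt
        have hP₁ : P (b, w.1.2) w' := ⟨h₁.symm, fun i hi => hP' i (by simp only at hi ⊢; omega)⟩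
        refine ⟨(b, w.1.2), Or.inl rfl, Or.inr (Or.inr ⟨trivial, Or.inl ?_⟩)⟩
        rw [hφP hP, hφP hP₁]
        simp only
        omega
  by_cases hb : b = y₀
  · subst hb
    have hz : z ≠ w.1.2 := fun hz => hP ⟨hz, hR _ hy⟩
    have hhb : G.h b = s := by simpa using hR _ hy 0 (Nat.zero_le _)
    have hφ : φ (b, z) w = n + ((w.1.2 - z) * s).val := by simp only [φ, if_neg hP, if_true]
    have hle := hφ₁ (e := (b, z + s)) (w := w') rfl
    simp only at hle
    refine ⟨(b, z + s), Or.inr (Or.inl ⟨rfl, by simp only [hhb]⟩), Or.inr (Or.inr ⟨trivial, ?_⟩)⟩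
    rcases hS.cases hs with ⟨h₁, h₂, -⟩ | ⟨-, -, h₃⟩ | ⟨h₁, -⟩
    · refine Or.inr ⟨?_, hTw, ?_⟩
      · rwa [hφ, show w.1.2 - z = w'.1.2 - (z + s) by rw [h₂]; ring]
      · rw [h₁]
        intro h
        exact ht0 (by linear_combination h)
    · exact absurd (hsy.symm.trans h₃) (sign_ne_neg hs)
    · have hne : (w.1.2 - z) * s ≠ 0 := by
        intro h0
        have : w.1.2 - z = 0 := by linear_combination s * h0 - (w.1.2 - z) * hss
        exact hz (sub_eq_zero.1 this).symm
      have hlt := val_sub_one_add_one hne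
      rw [h₁, show (w.1.2 - (z + s)) * s = (w.1.2 - z) * s - 1 by linear_combination -hss] at hle
      rw [hφ]
      exact Or.inl (by omega)
  · have hvv := sign_mul_self (G.v_sign z)
    have hne : (y₀ - b) * G.v z ≠ 0 := by
      intro h0
      have : y₀ - b = 0 := by linear_combination G.v z * h0 - (y₀ - b) * hvv
      exact hb (sub_eq_zero.1 this).symm
    have hlt := val_sub_one_add_one hne
    have hφ : φ (b, z) w = 2 * n + ((y₀ - b) * G.v z).val := by simp only [φ, if_neg hP, if_neg hb]
    have hle := hφ₀ (b + G.v z, z) w'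
    simp only at hle
    rw [show (y₀ - (b + G.v z)) * G.v z = (y₀ - b) * G.v z - 1 by linear_combination -hvv] at hle
    refine ⟨(b + G.v z, z), Or.inr (Or.inr ⟨rfl, rfl⟩), Or.inr (Or.inr ⟨trivial, Or.inl ?_⟩)⟩
    rw [hφ]
    omega

/-- A robber confined to a set of consecutive rows of the same direction is caught. The rows are
consecutive from `y₀` upwards and from `y₁` downwards. -/
theorem force_rows [Fact (3 ≤ n)] (hs : s = 1 ∨ s = -1) {R : Set (ZMod n)} {y₀ y₁ : ZMod n}
    (h₀ : ∀ y ∈ R, ∀ i : ℕ, i ≤ (y - y₀).val → G.h (y₀ + i) = s)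
    (h₁ : ∀ y ∈ R, ∀ i : ℕ, i ≤ (y₁ - y).val → G.h (y₁ - i) = s)
    (c : (Team.power G.Move G.move_refl 4).Pos) (w : Vertex n × Vertex n) :
    Force (Team.power G.Move G.move_refl 4) Prod.fst (G.RowsMove R) (fun _ _ => False) c w := by
  have H : Force (((G.cop.pair G.cop).pair G.cop).pair G.cop) Prod.fst (G.RowsMove R)
      (fun _ _ => False) (((c 0, c 1), c 2), c 3) w := by
    refine force_vertical (t := 1) (y₀ := y₀) hs (Or.inl rfl) (by simpa using h₀)
      (fun _ _ h => h) ?_ _ _ _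
    rintro ⟨c, e⟩ w
    refine force_vertical (t := -1) (y₀ := y₁) hs (Or.inr rfl) (R := R) ?_ (fun _ _ h => h.1) ?_
      _ _ _
    · simpa [← sub_eq_add_neg] using h₁
    · rintro ⟨c, e⟩ w
      refine Force.anti (T := G.RowMove) (Force.map (A := G.cop) (B := G.cop.pair G.cop)
        (Tgt := fun _ _ => False) (fun c => (c, e)) (fun _ _ h => ⟨h, Or.inl rfl⟩)
        (fun _ _ h => Or.inl h) (fun _ _ h => h.elim) (force_rowMove c w)) ?_
      rintro w w' ⟨⟨⟨hT, -, -⟩, h₁⟩, h₂⟩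
      refine ⟨hT, ?_⟩
      rcases hT.cases (Or.inl rfl) with h | h | ⟨-, h⟩
      · exact h.1
      · exact h.1
      · rcases G.v_sign w.1.2 with h' | h' <;> rw [h'] at h
        · exact absurd (by rw [h]; ring) h₂
        · exact absurd (by rw [h]; ring) h₁
  have hf : c = ![c 0, c 1, c 2, c 3] := by
    funext i
    fin_cases i <;> rfl
  rw [hf]
  exact Force.map (A := ((G.cop.pair G.cop).pair G.cop).pair G.cop)
    (B := Team.power G.Move G.move_refl 4) (Tgt := fun _ _ => False)
    (fun c => ![c.1.1.1, c.1.1.2, c.1.2, c.2])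
    (fun _ _ h i => by fin_cases i <;> [exact h.1.1.1; exact h.1.1.2; exact h.1.2; exact h.2])
    (fun _ _ h => by
      rcases h with ((h | h) | h) | h
      exacts [⟨0, h⟩, ⟨1, h⟩, ⟨2, h⟩, ⟨3, h⟩])
    (fun _ _ h => h.elim) H

end Dirs
end CopsRobber

/-! ### Enclosing the robber between guarded rows -/

namespace CopsRobber
namespace Dirs

variable {n : ℕ} {G : Dirs n} {s a : ZMod n} {L : ℕ} {w w' : Vertex n × Vertex n}

/-- The rows `a + 1, …, a + L`. -/
def rowInterval (a : ZMod n) (L : ℕ) : Set (ZMod n) := {y | (y - (a + 1)).val < L}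

theorem rowInterval_step [Fact (3 ≤ n)] (hL : L ≤ n) (hT : G.ShyMove w w')
    (hw : w.1.1 ∈ rowInterval a L) (h₁ : ¬ Crosses a (a + 1) w w')
    (h₂ : ¬ Crosses (a + (L : ZMod n)) (a + L + 1) w w') : w'.1.1 ∈ rowInterval a L := by
  have := neZero_of_three_le (n := n)
  simp only [rowInterval, Set.mem_ofPred_eq] at *
  rcases hT.cases (Or.inl rfl) with h | h | ⟨-, h⟩
  · rwa [h.1]
  · rwa [h.1]
  rcases G.v_sign w.1.2 with h' | h' <;> rw [h'] at h
  · rcases Nat.lt_or_ge ((w.1.1 - (a + 1)).val + 1) L with hlt | hge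
    · have := val_add_one_of_lt (hlt.trans_le hL)
      rw [h, show w.1.1 + 1 - (a + 1) = w.1.1 - (a + 1) + 1 by ring]
      omega
    · have hk : (w.1.1 - (a + 1)).val + 1 = L := by omega
      have hy : w.1.1 = a + L := by
        rw [← hk]
        push_cast
        rw [ZMod.natCast_zmod_val]
        ring
      exact absurd (Or.inl ⟨hy, by rw [h, hy]⟩) h₂
  · by_cases h0 : w.1.1 - (a + 1) = 0
    · exact absurd (Or.inr ⟨sub_eq_zero.1 h0, by rw [h]; linear_combination h0⟩) h₁
    · have := val_sub_one_add_one h0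
      rw [h, show w.1.1 + -1 - (a + 1) = w.1.1 - (a + 1) - 1 by ring]
      omega

/-- Four cops with two further ones, who serve as guards. -/
abbrev crew (G : Dirs n) : Team (Vertex n) :=
  (Team.power G.Move G.move_refl 4).pair (G.cop.pair G.cop)

theorem update_move {k : ℕ} {c d : Fin k → Vertex n} {e f : Vertex n} (i : Fin k)
    (h : ∀ j, G.Move (c j) (d j)) (h' : G.Move e f) (j : Fin k) :
    G.Move (Function.update c i e j) (Function.update d i f j) := by
  by_cases hj : j = i
  · subst hj; simpa using h'
  · simpa [hj] using h j

/-- One of the four cops exchanges roles with the first guard. -/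
theorem force_swap_left {T : Vertex n × Vertex n → Vertex n × Vertex n → Prop} (i : Fin 4)
    (c : Fin 4 → Vertex n) (e f : Vertex n)
    (h : Force G.crew Prod.fst T (fun _ _ => False) (Function.update c i e, (c i, f)) w) :
    Force G.crew Prod.fst T (fun _ _ => False) (c, (e, f)) w := by
  have := Force.map (A := G.crew) (B := G.crew) (Tgt := fun _ _ => False)
    (TgtB := fun _ _ => False) (fun c => (Function.update c.1 i c.2.1, (c.1 i, c.2.2)))
    (fun _ _ h => ⟨update_move i h.1 h.2.1, h.1 i, h.2.2⟩)
    (fun c x h => by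
      rcases h with ⟨j, h⟩ | h | h
      · by_cases hj : j = i
        · exact Or.inr (Or.inl (hj ▸ h))
        · exact Or.inl ⟨j, by simpa [hj] using h⟩
      · exact Or.inl ⟨i, by simpa using h⟩
      · exact Or.inr (Or.inr h))
    (fun _ _ h => h) h
  simpa using this

/-- The two guards exchange roles. -/
theorem force_swap_right {T : Vertex n × Vertex n → Vertex n × Vertex n → Prop}
    (c : Fin 4 → Vertex n) (e f : Vertex n)
    (h : Force G.crew Prod.fst T (fun _ _ => False) (c, (f, e)) w) :
    Force G.crew Prod.fst T (fun _ _ => False) (c, (e, f)) w :=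
  Force.map (A := G.crew) (B := G.crew) (Tgt := fun _ _ => False)
    (TgtB := fun _ _ => False) (fun c => (c.1, (c.2.2, c.2.1)))
    (fun _ _ h => ⟨h.1, h.2.2, h.2.1⟩) (fun _ _ h => Or.imp_right Or.symm h) (fun _ _ h => h) h

/-- Two guards keep the robber between them, while the other cops act. -/
theorem force_between [Fact (3 ≤ n)] (hL : L ≤ n) (ha : G.h (a + 1) = -G.h a)
    (hb : G.h (a + L + 1) = -G.h (a + L))
    {TgtX : (Team.power G.Move G.move_refl 4).Pos → Vertex n × Vertex n → Prop}
    (hA : ∀ c w, Force (Team.power G.Move G.move_refl 4) Prod.fst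
      (G.RowsMove (rowInterval a L)) TgtX c w)
    (hdone : ∀ c e f w, TgtX c w → G.Guard a (G.h a) 1 e w →
      G.Guard (a + L) (G.h (a + L)) 1 f w → w.1.1 ∈ rowInterval a L →
      Force G.crew Prod.fst G.ShyMove (fun _ _ => False) (c, (e, f)) w)
    (c : Fin 4 → Vertex n) (e f : Vertex n) (w : Vertex n × Vertex n)
    (he : G.Guard a (G.h a) 1 e w) (hf : G.Guard (a + L) (G.h (a + L)) 1 f w)
    (hw : w.1.1 ∈ rowInterval a L) :
    Force G.crew Prod.fst G.ShyMove (fun _ _ => False) (c, (e, f)) w := by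
  refine Force.restrict (X := G.cop.pair G.cop)
    (fun x w => G.Guard a (G.h a) 1 x.1 w ∧ G.Guard (a + L) (G.h (a + L)) 1 x.2 w ∧
      w.1.1 ∈ rowInterval a L) (fun _ _ => 0) hA
    (fun c x w h h' => hdone c x.1 x.2 w h h'.1 h'.2.1 h'.2.2) ?_ c (e, f) w ⟨he, hf, hw⟩
  rintro ⟨e, f⟩ w w' ⟨he, hf, hw⟩ - hT
  obtain ⟨e', h₁, h₂⟩ := he.step (G.h_sign a) (Or.inl rfl) rfl ha hT
  obtain ⟨f', h₃, h₄⟩ := hf.step (G.h_sign _) (Or.inl rfl) rfl hb hT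
  refine ⟨(e', f'), ⟨h₁, h₃⟩, ?_⟩
  rcases h₂ with h₂ | ⟨h₂, h₂'⟩
  · exact Or.inl (Or.inl h₂)
  rcases h₄ with h₄ | ⟨h₄, h₄'⟩
  · exact Or.inl (Or.inr h₄)
  have hw' := rowInterval_step hL hT hw h₂' h₄'
  exact Or.inr (Or.inr ⟨⟨h₂, h₄, hw'⟩, Or.inr ⟨le_rfl, hT, hw, hw'⟩⟩)

theorem force_rowInterval [Fact (3 ≤ n)] (hs : s = 1 ∨ s = -1) (hL : L ≤ n)
    (h : ∀ i < L, G.h (a + 1 + i) = s) (c : (Team.power G.Move G.move_refl 4).Pos)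
    (w : Vertex n × Vertex n) :
    Force (Team.power G.Move G.move_refl 4) Prod.fst (G.RowsMove (rowInterval a L))
      (fun _ _ => False) c w := by
  have := neZero_of_three_le (n := n)
  refine force_rows (y₀ := a + 1) (y₁ := a + L) hs (fun y hy i hi => h i (hi.trans_lt hy)) ?_ c w
  intro y hy i hi
  have hy : (y - (a + 1)).val < L := hy
  have hval : (a + L - y).val = L - 1 - (y - (a + 1)).val := by
    rw [← ZMod.val_natCast_of_lt (n := n) (a := L - 1 - (y - (a + 1)).val) (by omega)]
    congr 1
    rw [Nat.cast_sub (by omega), Nat.cast_sub (by omega), ZMod.natCast_zmod_val]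
    push_cast
    ring
  have := h (L - 1 - i) (by omega)
  rw [Nat.cast_sub (by omega), Nat.cast_sub (by omega)] at this
  rwa [show a + 1 + ((L : ZMod n) - (1 : ℕ) - i) = a + L - i by push_cast; ring] at this

/-- A robber between two guards is caught: as long as there is a change of direction between them,
a third guard can be placed at the first one, and then one of the old guards is superfluous. -/
theorem force_of_guards [Fact (3 ≤ n)] (L : ℕ) : ∀ (a : ZMod n), 0 < L → L ≤ n →
    G.h (a + 1) = -G.h a → G.h (a + L + 1) = -G.h (a + L) →
    ∀ (c : Fin 4 → Vertex n) (e f : Vertex n) (w : Vertex n × Vertex n),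
    G.Guard a (G.h a) 1 e w → G.Guard (a + L) (G.h (a + L)) 1 f w → w.1.1 ∈ rowInterval a L →
    Force G.crew Prod.fst G.ShyMove (fun _ _ => False) (c, (e, f)) w := by
  classical
  have := neZero_of_three_le (n := n)
  induction L using Nat.strong_induction_on with
  | _ L ih =>
    intro a hL0 hL ha hb
    have hex : ∃ j : ℕ, 0 < j ∧ G.h (a + j + 1) = -G.h (a + j) := ⟨L, hL0, hb⟩
    obtain ⟨hj0, hj⟩ := Nat.find_spec hex
    have hjL : Nat.find hex ≤ L := Nat.find_min' hex ⟨hL0, hb⟩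
    have hmin : ∀ i < Nat.find hex, ¬ (0 < i ∧ G.h (a + i + 1) = -G.h (a + i)) :=
      fun i hi => Nat.find_min hex hi
    generalize Nat.find hex = j at hj0 hj hjL hmin
    -- The rows up to the first change of direction have the same direction.
    have hrows : ∀ i < j, G.h (a + 1 + i) = G.h (a + 1) := by
      intro i
      induction i with
      | zero => simp
      | succ i ihi =>
        intro hi
        rw [← ihi (by omega)]
        have h₁ := hmin (i + 1) hi
        have h₂ := sign_eq_or (G.h_sign (a + (i + 1 : ℕ))) (G.h_sign (a + (i + 1 : ℕ) + 1))
        have h₃ := h₂.resolve_right (fun h => h₁ ⟨by omega, h⟩)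
        rw [show a + 1 + ((i + 1 : ℕ) : ZMod n) = a + (i + 1 : ℕ) + 1 by ring, h₃]
        congr 1
        push_cast
        ring
    have hbase := force_rowInterval (G.h_sign (a + 1)) (hjL.trans hL) hrows
    rcases hjL.eq_or_lt with rfl | hjL
    · exact force_between hL ha hb hbase (fun _ _ _ _ h => h.elim)
    refine force_between hL ha hb (fun c w => Force.anti
      (force_guard (p := a + (j : ZMod n)) (t := 1) (G.h_sign (a + j)) rfl c w) fun _ _ h => h.1) ?_
    rintro c e f w ⟨i, hi⟩ he hf hw
    have hw : (w.1.1 - (a + 1)).val < L := hw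
    rcases Nat.lt_or_ge (w.1.1 - (a + 1)).val j with hlt | hge
    · -- The robber is below the new guard, who replaces the upper one.
      refine force_swap_right c e f (force_swap_left i c f e (force_swap_right _ _ _ ?_))
      exact force_between (hjL.le.trans hL) ha hj hbase (fun _ _ _ _ h => h.elim) _ _ _ _ he hi hlt
    · -- The robber is above the new guard, who replaces the lower one.
      refine force_swap_left i c e f ?_
      have hcast : a + (j : ZMod n) + ((L - j : ℕ) : ZMod n) = a + L := by
        rw [Nat.cast_sub hjL.le]; ring
      refine ih (L - j) (by omega) (a + j) (by omega) (by omega) hj (by rwa [hcast]) _ _ _ _ hi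
        (by rwa [hcast]) ?_
      have hval : (w.1.1 - (a + j + 1)).val = (w.1.1 - (a + 1)).val - j := by
        rw [← ZMod.val_natCast_of_lt (n := n) (a := (w.1.1 - (a + 1)).val - j) (by omega)]
        congr 1
        rw [Nat.cast_sub hge, ZMod.natCast_zmod_val]
        ring
      have : (w.1.1 - (a + j + 1)).val < L - j := by omega
      exact this

/-- Six cops catch a robber who neither stays nor steps onto his shadow. -/
theorem force_shyMove [Fact (3 ≤ n)] (c : Fin 4 → Vertex n) (e f : Vertex n)
    (w : Vertex n × Vertex n) :
    Force G.crew Prod.fst G.ShyMove (fun _ _ => False) (c, (e, f)) w := by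
  have := neZero_of_three_le (n := n)
  by_cases hex : ∃ a, G.h (a + 1) = -G.h a
  · obtain ⟨a, ha⟩ := hex
    -- Both guards are placed at the same change of direction.
    have hguard := force_guard (t := 1) (G.h_sign a) rfl
    have hL : a + ((n : ℕ) : ZMod n) = a := by simp
    have hend : ∀ (c : Fin 4 → Vertex n) (e f : Vertex n) (w : Vertex n × Vertex n),
        G.Guard a (G.h a) 1 e w →
        Force G.crew Prod.fst G.ShyMove (fun _ _ => False) (c, (e, f)) w := by
      intro c e f w he
      refine Force.restrict (X := G.cop.pair G.cop) (fun x w => G.Guard a (G.h a) 1 x.1 w)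
        (fun _ _ => 0) hguard ?_ ?_ c (e, f) w he
      · rintro c ⟨e, f⟩ w ⟨i, hi⟩ he
        refine force_swap_right c e f (force_swap_left i c f e (force_swap_right _ _ _ ?_))
        exact force_of_guards n a (NeZero.pos n) le_rfl ha (by rwa [hL]) _ _ _ _ he (by rwa [hL])
          (ZMod.val_lt _)
      · rintro ⟨e, f⟩ w w' he - hT
        obtain ⟨e', h, h' | ⟨h', -⟩⟩ := Guard.step (G.h_sign a) (Or.inl rfl) rfl ha he hT
        · exact ⟨(e', f), ⟨h, Or.inl rfl⟩, Or.inl (Or.inl h')⟩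
        · exact ⟨(e', f), ⟨h, Or.inl rfl⟩, Or.inr (Or.inr ⟨h', Or.inr ⟨le_rfl, hT⟩⟩)⟩
    refine Force.bind (Force.map (A := Team.power G.Move G.move_refl 4) (B := G.crew)
      (TgtB := fun c w => ∃ i, G.Guard a (G.h a) 1 (c.1 i) w) (fun c => (c, (e, f)))
      (fun _ _ h => ⟨h, Or.inl rfl, Or.inl rfl⟩) (fun _ _ h => Or.inl h) (fun _ _ h => h)
      (hguard c w)) ?_
    rintro ⟨c, e, f⟩ w ⟨i, hi⟩
    exact force_swap_left i c e f (hend _ _ _ _ hi)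
  · -- All rows have the same direction.
    have hrows : ∀ i < n, G.h (0 + 1 + (i : ℕ)) = G.h (0 + 1) := by
      intro i hi
      clear hi
      induction i with
      | zero => simp
      | succ i ihi =>
        rw [← ihi]
        have h₂ := (sign_eq_or (G.h_sign (0 + 1 + i)) (G.h_sign (0 + 1 + i + 1))).resolve_right
          fun h => hex ⟨_, h⟩
        rw [← h₂]
        congr 1
        push_cast
        ring
    refine Force.map (A := Team.power G.Move G.move_refl 4) (B := G.crew)
      (Tgt := fun _ _ => False) (fun c => (c, (e, f)))
      (fun _ _ h => ⟨h, Or.inl rfl, Or.inl rfl⟩) (fun _ _ h => Or.inl h) (fun _ _ h => h)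
      (Force.anti (force_rowInterval (a := 0) (G.h_sign _) le_rfl hrows c w) fun w w' h => ?_)
    exact ⟨h, ZMod.val_lt _, ZMod.val_lt _⟩

end Dirs
end CopsRobber

/-! ### Straight-ahead orientations -/

namespace CopsRobber

/-- An injective enumeration of a cycle along which consecutive terms differ by `±1` goes around in
one direction. -/
theorem exists_sign_of_cycle {n : ℕ} [Fact (3 ≤ n)] (g : ZMod n → ZMod n)
    (hg : Function.Injective g) (hstep : ∀ k, g (k + 1) = g k + 1 ∨ g (k + 1) = g k - 1) :
    ∃ s : ZMod n, (s = 1 ∨ s = -1) ∧ ∀ k, g (k + 1) = g k + s := by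
  have := neZero_of_three_le (n := n)
  have hne : ∀ k, g (k + 1 + 1) ≠ g k := fun k h => by
    have h := hg h
    exact one_ne_neg_one (n := n) (by linear_combination h)
  have hs : g (0 + 1) - g 0 = 1 ∨ g (0 + 1) - g 0 = -1 := by
    rcases hstep 0 with h | h <;> rw [h]
    · left; ring
    · right; ring
  refine ⟨g (0 + 1) - g 0, hs, fun k => ?_⟩
  have key : ∀ i : ℕ, g ((i : ZMod n) + 1) = g i + (g (0 + 1) - g 0) := by
    intro i
    induction i with
    | zero => simp
    | succ i ih =>
      have h₁ := hne i
      rcases hstep ((i : ZMod n) + 1) with h | h <;> push_cast <;> rcases hs with hs | hs <;>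
        rw [hs] at ih ⊢
      · exact h
      · exact absurd (by rw [h, ih]; ring) h₁
      · exact absurd (by rw [h, ih]; ring) h₁
      · rw [h]; ring
  simpa using key k.val

theorem IsDirectedCycle.exists_sign {m : ℕ} [hm : Fact (3 ≤ m + 1)] {D : Digraph (Fin (m + 1))}
    (hD : IsDirectedCycle D (m + 1))
    (hadj : ∀ u w, D.Adj u w → (SimpleGraph.cycleGraph (m + 1)).Adj u w) :
    ∃ s : ZMod (m + 1), (s = 1 ∨ s = -1) ∧ ∀ u w : ZMod (m + 1), D.Adj u w ↔ w = u + s := by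
  obtain ⟨f⟩ := hD
  let e : ZMod (m + 1) ≃ ZMod (m + 1) := f.toEquiv
  have he : ∀ u w : ZMod (m + 1), D.Adj u w ↔ e w = e u + 1 := by
    intro u w
    have h1 : (1 : ZMod (m + 1)).val = 1 := ZMod.val_one'' (by have := hm.out; omega)
    rw [← (ZMod.val_injective (m + 1)).eq_iff, ZMod.val_add, h1]
    exact (f.map_rel_iff (a := u) (b := w)).symm
  obtain ⟨s, hs, h⟩ := exists_sign_of_cycle e.symm e.symm.injective fun k => by
    have hD := (he (e.symm k) (e.symm (k + 1))).2 (by simp)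
    have h1 : (1 : ZMod (m + 1)).val = 1 := ZMod.val_one'' (by have := hm.out; omega)
    rcases SimpleGraph.cycleGraph_adj'.1 (hadj _ _ hD) with h | h
    · have h : (e.symm k - e.symm (k + 1)).val = (1 : ZMod (m + 1)).val := h.trans h1.symm
      have := ZMod.val_injective (m + 1) h
      exact Or.inr (by linear_combination -this)
    · have h : (e.symm (k + 1) - e.symm k).val = (1 : ZMod (m + 1)).val := h.trans h1.symm
      have := ZMod.val_injective (m + 1) h
      exact Or.inl (by linear_combination this)
  refine ⟨s, hs, fun u w => (he u w).trans ?_⟩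
  rw [← e.symm_apply_eq.trans eq_comm, h, e.symm_apply_apply, eq_comm]

/-- A straight-ahead orientation is given by the directions of the rows and columns. -/
theorem IsStraightAhead.exists_dirs {m : ℕ} [Fact (3 ≤ m + 1)]
    {D : Digraph (Fin (m + 1) × Fin (m + 1))} (hD : IsStraightAhead D) :
    ∃ G : Dirs (m + 1), ∀ u w : Vertex (m + 1), D.Adj u w ↔ G.Arc u w := by
  have hadj : ∀ u w, D.Adj u w → (toroidalGrid (m + 1)).Adj u w := fun u w h =>
    (hD.orientation.adj_iff u w).2 (Or.inl h)
  have hrow := fun y => (hD.row y).exists_sign fun u w h => by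
    simpa using hadj (y, u) (y, w) h
  have hcol := fun x => (hD.column x).exists_sign fun u w h => by
    simpa using hadj (u, x) (w, x) h
  choose h hh hh' using hrow
  choose v hv hv' using hcol
  refine ⟨⟨h, v, hh, hv⟩, ?_⟩
  rintro ⟨y, x⟩ ⟨y', x'⟩
  constructor
  · intro hA
    rcases hadj _ _ hA with ⟨-, rfl : x = x'⟩ | ⟨-, rfl : y = y'⟩
    · exact Or.inr ⟨rfl, (hv' x y y').1 hA⟩
    · exact Or.inl ⟨rfl, (hh' y x x').1 hA⟩
  · rintro (⟨rfl : y' = y, hA⟩ | ⟨rfl : x' = x, hA⟩)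
    · exact (hh' y' x x').2 hA
    · exact (hv' x' y y').2 hA

/-- Eight cops suffice: the four of `Dirs.force_guard`, two guards, and the two chasing cops. -/
theorem Dirs.force_move {n : ℕ} [Fact (3 ≤ n)] (G : Dirs n)
    (c : (Team.power G.Move G.move_refl 8).Pos) (r : Vertex n) :
    Force (Team.power G.Move G.move_refl 8) id G.Move (fun _ _ => False) c r := by
  have H : Force ((G.crew.pair G.cop).pair G.cop) id G.Move (fun _ _ => False)
      (((![c 0, c 1, c 2, c 3], (c 4, c 5)), c 6), c 7) r := by
    refine force_of_shadow (w := (r, r)) (force_fullMove ?_ _ _ _)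
    rintro ⟨c, g⟩ w
    exact force_arcMove (A := G.crew) (fun c w => force_shyMove c.1 c.2.1 c.2.2 w) c g w
  have hf : c = ![c 0, c 1, c 2, c 3, c 4, c 5, c 6, c 7] := by
    funext i
    fin_cases i <;> rfl
  rw [hf]
  exact Force.map (A := (G.crew.pair G.cop).pair G.cop)
    (B := Team.power G.Move G.move_refl 8) (Tgt := fun _ _ => False)
    (fun c => ![c.1.1.1 0, c.1.1.1 1, c.1.1.1 2, c.1.1.1 3, c.1.1.2.1, c.1.1.2.2, c.1.2, c.2])
    (fun _ _ h i => by
      fin_cases i <;> [exact h.1.1.1 0; exact h.1.1.1 1; exact h.1.1.1 2; exact h.1.1.1 3;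
        exact h.1.1.2.1; exact h.1.1.2.2; exact h.1.2; exact h.2])
    (fun _ _ h => by
      rcases h with ((⟨i, h⟩ | h | h) | h) | h
      · exact ⟨i.castLE (by norm_num), by fin_cases i <;> exact h⟩
      exacts [⟨4, h⟩, ⟨5, h⟩, ⟨6, h⟩, ⟨7, h⟩])
    (fun _ _ h => h.elim) H

end CopsRobber

theorem mainTheorem2 (n : ℕ) (hn : 3 ≤ n) (D : Digraph (Fin n × Fin n))
    (hD : CopsRobber.IsStraightAhead D) :
    CopsRobber.copNumber D ≤ 319 := by
  obtain ⟨m, rfl⟩ : ∃ m, n = m + 1 := ⟨n - 1, by omega⟩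
  have : Fact (3 ≤ m + 1) := ⟨hn⟩
  obtain ⟨G, hG⟩ := hD.exists_dirs
  have hmove : CopsRobber.Step D = G.Move := by
    funext u w
    exact propext (or_congr Iff.rfl (hG u w))
  have hwin : CopsRobber.CopsWin D 8 :=
    CopsRobber.copsWin_of_force G.move_refl hmove G.force_move
  exact (iInf₂_le 8 hwin).trans (by norm_num)
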